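/- **Setting.** For a positive integer $M$ let $U_M$ be the uniform distribution on $\{0,1\}^M$, and let $d_{\mathrm{TV}}(P,Q)=\frac12\sum_x|P(x)-Q(x)|$. For $S\subseteq[M]$ and $b\in\mathbb{R}$ let $Q_M^{S,b}$ be the Ising model on $\{0,1\}^M$ with mass function $$Q_M^{S,b}(x)=\frac1Z\exp\Big(\tfrac12\sum_{i,j\in[M]}(-1)^{x_i+x_j}\theta_{ij}\Big),$$ where $\theta_{ij}=b$ if $i\neq j$ and $i,j\in S$, $\theta_{ij}=0$ otherwise, and $Z$ is the normalizing constant. A statistical query of tolerance $t>0$ is a function $f:\{0,1\}^M\to[-1,1]$; when the unknown distribution is $P$, the oracle may answer it by any real $v$ with $|v-\mathbf{E}_{X\sim P}[f(X)]|\le t$. A statistical query (SQ) algorithm is a randomized algorithm that accesses the unknown distribution only through adaptively chosen statistical queries (of tolerances that it chooses), and then outputs a verdict, $H_0$ or $H_1$. Logarithms are natural. **Theorem.** For every constant $A>0$ there are a positive integer $k_0$ and constants $c_0,C',a>0$, depending only on $A$, such that the following holds. Let $k\ge k_0$ be an integer, let $m,M$ be positive integers with $M=3m^{5/4}$, let $0<\epsilon<1/2$,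 let $$0<\delta\le c_0\,\frac{\epsilon\log(1/\epsilon)}{k^3},\qquad \tau\ge A\,M^{-(k+1)/5}\,\delta ,$$ and assume that $m>\max\Big(C'(\log(1/\epsilon))^3,\ \frac{k^2}{\log(1/\delta)}\Big)$. Consider any SQ algorithm that is given access to a distribution $\mathbf{P}$ over $\{0,1\}^M$ such that either * $H_0$: $\mathbf{P}=U_M$, or * $H_1$: $d_{\mathrm{TV}}\big(\mathbf{P},Q_M^{S,\delta/m}\big)\le\epsilon$ for some unknown $S\subseteq[M]$ with $|S|=m$, and that, for every such $\mathbf{P}$ and every valid way of answering its queries, outputs the correct hypothesis with probability at least $2/3$. Then, for some such $\mathbf{P}$ and some valid way of answering the queries, the algorithm with positive probability either makes a query of tolerance smaller than $\sqrt{2\tau}$ or makes at least $$2^{a M^{2/5}}\,M^{-(k+1)/5}$$ statistical queries. -/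

import Mathlib

/-- The hypercube `{0,1}^M`. -/
abbrev Hypercube (M : ℕ) : Type := Fin M → Fin 2

/-- The expectation `E_{X ∼ P}[f(X)]` of a real function under a distribution on `{0,1}^M`. -/
noncomputable def cubeExpectation {M : ℕ} (P : PMF (Hypercube M)) (f : Hypercube M → ℝ) : ℝ :=
  ∑ x, (P x).toReal * f x

/-- Total variation distance `(1/2) ∑ₓ |P(x) - Q(x)|` of two distributions on `{0,1}^M`. -/
noncomputable def tvDistance {M : ℕ} (P Q : PMF (Hypercube M)) : ℝ :=
  (1 / 2) * ∑ x, |(P x).toReal - (Q x).toReal|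

/-! ### Ising models -/

/-- An interaction matrix: real, symmetric, with zero diagonal. -/
structure InteractionMatrix (M : ℕ) where
  entry : Matrix (Fin M) (Fin M) ℝ
  symm : entry.IsSymm
  zero_diag : ∀ i, entry i i = 0

/-- The unnormalised weight `exp((1/2) ∑_{i,j} (-1)^{x_i + x_j} θ_{ij})`. -/
noncomputable def isingWeight {M : ℕ} (θ : InteractionMatrix M) (x : Hypercube M) : ℝ :=
  Real.exp ((1 / 2) * ∑ i, ∑ j, (-1 : ℝ) ^ ((x i : ℕ) + (x j : ℕ)) * θ.entry i j)

theorem isingWeight_tsum_ne_zero {M : ℕ} (θ : InteractionMatrix M) :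
    ∑' x, ENNReal.ofReal (isingWeight θ x) ≠ 0 := by
  rw [tsum_fintype]
  have h : 0 < ENNReal.ofReal (isingWeight θ (fun _ => 0)) :=
    ENNReal.ofReal_pos.2 (Real.exp_pos _)
  exact (lt_of_lt_of_le h (Finset.single_le_sum
    (f := fun x => ENNReal.ofReal (isingWeight θ x)) (fun _ _ => zero_le)
    (Finset.mem_univ _))).ne'

theorem isingWeight_tsum_ne_top {M : ℕ} (θ : InteractionMatrix M) :
    ∑' x, ENNReal.ofReal (isingWeight θ x) ≠ ⊤ := by
  rw [tsum_fintype]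
  exact ENNReal.sum_ne_top.2 fun _ _ => ENNReal.ofReal_ne_top

/-- The Ising model `P_θ` over `{0,1}^M`: its mass function is the weight divided by the partition
function `Z(θ)`, the sum of all the weights. -/
noncomputable def isingModel {M : ℕ} (θ : InteractionMatrix M) : PMF (Hypercube M) :=
  PMF.normalize (fun x => ENNReal.ofReal (isingWeight θ x))
    (isingWeight_tsum_ne_zero θ) (isingWeight_tsum_ne_top θ)

/-- The interaction matrix with `θ_{ij} = b` for all `i ≠ j` in `S`, and `θ_{ij} = 0` otherwise. -/
def cliqueInteraction {M : ℕ} (S : Finset (Fin M)) (b : ℝ) : InteractionMatrix M where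
  entry := Matrix.of fun i j => if i ≠ j ∧ i ∈ S ∧ j ∈ S then b else 0
  symm := by
    ext i j
    simp only [Matrix.transpose_apply, Matrix.of_apply]
    exact if_congr (by tauto) rfl rfl
  zero_diag := by simp

/-- The Ising model `Q_M^{S,b}`: every pair of distinct indices of `S` has interaction `b`, and all
other interactions vanish. -/
noncomputable def cliqueIsing {M : ℕ} (S : Finset (Fin M)) (b : ℝ) : PMF (Hypercube M) :=
  isingModel (cliqueInteraction S b)

/-! ### Statistical query algorithms -/

/-- A statistical query to the oracle `STAT(tol)`: a function `f` on `{0,1}^M` with values in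
`[-1,1]`, together with the tolerance `tol > 0` that is asked for. -/
structure StatQuery (M : ℕ) where
  f : Hypercube M → ℝ
  mem_Icc : ∀ x, f x ∈ Set.Icc (-1 : ℝ) 1
  tol : ℝ
  tol_pos : 0 < tol

/-- A rule for answering statistical queries. -/
abbrev QueryOracle (M : ℕ) : Type := StatQuery M → ℝ

/-- The oracle is a legitimate `STAT` oracle for `P`: each query is answered up to its tolerance. -/
def QueryOracle.IsSTAT {M : ℕ} (O : QueryOracle M) (P : PMF (Hypercube M)) : Prop :=
  ∀ q : StatQuery M, |O q - cubeExpectation P q.f| ≤ q.tol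

/-- The two possible outputs of a testing algorithm. -/
inductive Verdict
  | null
  | alternative

/-- A deterministic adaptive statistical query algorithm for a testing problem: it either stops
with a verdict, or makes a query and goes on in a way that depends on the answer received. -/
inductive SQAlgorithm (M : ℕ) : Type
  | output (v : Verdict) : SQAlgorithm M
  | query (q : StatQuery M) (next : ℝ → SQAlgorithm M) : SQAlgorithm M

/-- The verdict that the algorithm reaches with the oracle `O`. -/
def SQAlgorithm.verdict {M : ℕ} (O : QueryOracle M) : SQAlgorithm M → Verdict
  | .output v => v
  | .query q next => SQAlgorithm.verdict O (next (O q))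

/-- The list of the queries that the algorithm makes when it is run with the oracle `O`. -/
def SQAlgorithm.queries {M : ℕ} (O : QueryOracle M) : SQAlgorithm M → List (StatQuery M)
  | .output _ => []
  | .query q next => q :: SQAlgorithm.queries O (next (O q))

/-- A randomized algorithm is a family of deterministic ones indexed by the outcome `ω` of its
internal randomness. When its unknown distribution is `P`, it returns `v` with probability at least
`2/3`: whichever legitimate oracle for `P` answers, there is an event of probability at least `2/3`
on which the verdict is `v`. (For a measurable success set this says that the probability of the
verdict `v` is at least `2/3`; no measurability of the algorithm itself is needed.) -/
def ReturnsWithProbTwoThirds {M : ℕ} {Ω : Type*} [MeasurableSpace Ω]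
    (μ : MeasureTheory.Measure Ω) (alg : Ω → SQAlgorithm M)
    (P : PMF (Hypercube M)) (v : Verdict) : Prop :=
  ∀ O : QueryOracle M, O.IsSTAT P →
    ∃ E : Set Ω, MeasurableSet E ∧ 2 / 3 ≤ μ E ∧ ∀ ω ∈ E, (alg ω).verdict O = v

/-- The randomized algorithm distinguishes the hypotheses `H₀` and `H₁` (sets of distributions):
it is correct with probability at least `2/3` on every distribution of either. -/
def Distinguishes {M : ℕ} {Ω : Type*} [MeasurableSpace Ω]
    (μ : MeasureTheory.Measure Ω) (alg : Ω → SQAlgorithm M)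
    (H₀ H₁ : Set (PMF (Hypercube M))) : Prop :=
  (∀ P ∈ H₀, ReturnsWithProbTwoThirds μ alg P Verdict.null) ∧
  (∀ P ∈ H₁, ReturnsWithProbTwoThirds μ alg P Verdict.alternative)

/-- The null hypothesis: the unknown distribution is the uniform distribution `U_M`. -/
noncomputable def uniformHypothesis (M : ℕ) : Set (PMF (Hypercube M)) :=
  {PMF.uniformOfFintype (Hypercube M)}

/-- The alternative: the unknown distribution is `ε`-close in total variation distance to
`Q_M^{S,b}` for some `S ⊆ [M]` with `|S| = m`. -/
def corruptedIsingHypothesis (M m : ℕ) (b ε : ℝ) : Set (PMF (Hypercube M)) :=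
  {P | ∃ S : Finset (Fin M), S.card = m ∧ tvDistance P (cliqueIsing S b) ≤ ε}

/-! The null answers `E_U[f]` are legitimate for an alternative `P` whenever the query's tolerance
is at least its discrepancy between `P` and uniform. It is enough to find one alternative per
`m`-set `S`, each within `ε` of the clique model, such that no query of tolerance at least `√(2τ)`
separates more than a tiny fraction of them from uniform.

If `60δ ≤ ε`, the uniform distribution is itself an alternative and no tester exists. Otherwise `ε <
60δ`, and the upper bound on `δ` forces `log(1/ε) ≥ 1000k³`.

Under the clique model the number of ones in `S` has an explicit density with respect to
`Bin(m,1/2)`, of the form `exp(δy²/2)` up to normalisation, with `y` the standardised count. An `L¹`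
change of at most `2ε` gives a nonnegative density `g` with the same moments as the binomial up to
order `k` (`exists_moment_correction`). By Hahn–Banach, only a pairing inequality for each
polynomial `p` of degree at most `k` is needed. Let `B` be the maximum of `|p|` on `[-R,R]`.
Chebyshev coefficients are at most `2B`, so the moment defect pairs with `p` to at most `εB`;
moreover `|p|` stays above `B/2` on a window of width about `R/k³`. A bump of `L¹` mass `2ε` there
pairs to at least `εB`. With `R² = log(1/ε)/4` the window has mass of order at least `w·ε^(1/4)`, so
the bump can be kept below height `1/2`.

Lifted to the cube, `g - 1` has Fourier coefficients that are supported inside `S`, depend only on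
the size of the index set, and vanish up to size `k`. By Parseval the correlation of the lifts for
`S` and `T` is at most `(|S∩T|/m)^(k+1)` times their squared norm (`abs_cubeMean_mul_weight_le`).
Intersections rarely exceed a multiple of `m²/M`, which is of order `m^(3/4)`, so most pairs have
correlation at most `τ`. A second-moment argument (`card_detected_mul_le`) bounds how many
alternatives one query detects, and averaging over the algorithm's randomness
(`measure_pos_of_distinguishes`) bounds the number of queries. -/

namespace IsingSQ

open Finset

/-! ### Binomial means and sub-Gaussian moments. -/

/-- The mean of `φ` under the binomial distribution `Bin(m, 1/2)`. -/
noncomputable def binMean (m : ℕ) (φ : ℕ → ℝ) : ℝ :=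
  (∑ j ∈ range (m + 1), (m.choose j : ℝ) * φ j) / 2 ^ m

/-- The standardised value `(m - 2j)/√m` of a binomial count `j`. -/
noncomputable def stdz (m j : ℕ) : ℝ := ((m : ℝ) - 2 * j) / Real.sqrt m

theorem binMean_add (m : ℕ) (φ ψ : ℕ → ℝ) :
    binMean m (fun j => φ j + ψ j) = binMean m φ + binMean m ψ := by
  simp only [binMean, mul_add, sum_add_distrib, add_div]

theorem binMean_mul_left (m : ℕ) (c : ℝ) (φ : ℕ → ℝ) :
    binMean m (fun j => c * φ j) = c * binMean m φ := by
  simp only [binMean, mul_left_comm _ c, ← mul_sum, mul_div_assoc]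

theorem binMean_sub (m : ℕ) (φ ψ : ℕ → ℝ) :
    binMean m (fun j => φ j - ψ j) = binMean m φ - binMean m ψ := by
  simp only [binMean, mul_sub, sum_sub_distrib, sub_div]

theorem binMean_sum {ι : Type*} (m : ℕ) (s : Finset ι) (φ : ι → ℕ → ℝ) :
    binMean m (fun j => ∑ i ∈ s, φ i j) = ∑ i ∈ s, binMean m (φ i) := by
  simp only [binMean, mul_sum, ← sum_div]
  rw [sum_comm]

theorem binMean_mono {m : ℕ} {φ ψ : ℕ → ℝ} (h : ∀ j ≤ m, φ j ≤ ψ j) :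
    binMean m φ ≤ binMean m ψ := by
  unfold binMean
  gcongr with j hj
  exact h j (by simpa [Nat.lt_succ_iff] using hj)

theorem binMean_congr {m : ℕ} {φ ψ : ℕ → ℝ} (h : ∀ j ≤ m, φ j = ψ j) :
    binMean m φ = binMean m ψ :=
  le_antisymm (binMean_mono fun j hj => (h j hj).le) (binMean_mono fun j hj => (h j hj).ge)

theorem binMean_const (m : ℕ) (c : ℝ) : binMean m (fun _ => c) = c := by
  unfold binMean
  rw [← sum_mul]
  have : (∑ j ∈ range (m + 1), (m.choose j : ℝ)) = 2 ^ m := by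
    exact_mod_cast Nat.sum_range_choose m
  rw [this]
  field_simp

theorem binMean_nonneg {m : ℕ} {φ : ℕ → ℝ} (h : ∀ j ≤ m, 0 ≤ φ j) : 0 ≤ binMean m φ := by
  have := binMean_mono (m := m) (φ := fun _ => 0) (ψ := φ) h
  rwa [binMean_const] at this

theorem abs_binMean_le (m : ℕ) (φ : ℕ → ℝ) : |binMean m φ| ≤ binMean m (fun j => |φ j|) := by
  unfold binMean
  rw [abs_div, abs_of_pos (by positivity : (0 : ℝ) < 2 ^ m)]
  gcongr
  refine (abs_sum_le_sum_abs _ _).trans (le_of_eq ?_)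
  exact sum_congr rfl fun j _ => by rw [abs_mul, Nat.abs_cast]

theorem binMean_reflect (m : ℕ) (φ : ℕ → ℝ) :
    binMean m (fun j => φ (m - j)) = binMean m φ := by
  unfold binMean
  congr 1
  rw [← sum_range_reflect]
  refine sum_congr rfl fun j hj => ?_
  have hj' : j ≤ m := by simpa [Nat.lt_succ_iff] using hj
  have : m + 1 - 1 - j = m - j := by omega
  simp only [this, Nat.choose_symm hj', Nat.sub_sub_self hj']

theorem stdz_reflect {m j : ℕ} (hj : j ≤ m) : stdz m (m - j) = -stdz m j := by
  unfold stdz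
  rw [Nat.cast_sub hj]
  ring

theorem binMean_odd (m : ℕ) (φ : ℕ → ℝ) (h : ∀ j ≤ m, φ (m - j) = -φ j) : binMean m φ = 0 := by
  have h1 : binMean m (fun j => φ (m - j)) = -1 * binMean m φ := by
    rw [← binMean_mul_left]
    exact binMean_congr fun j hj => by rw [h j hj]; ring
  rw [binMean_reflect] at h1
  linarith

/-- The count is a sum of independent signs, so the left side is exactly `cosh(t/√m)^m`, and `cosh s
≤ exp(s²/2)`. -/
theorem binMean_exp_le {m : ℕ} (hm : 0 < m) (t : ℝ) :
    binMean m (fun j => Real.exp (t * stdz m j)) ≤ Real.exp (t ^ 2 / 2) := by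
  have hs : 0 < Real.sqrt m := Real.sqrt_pos.2 (by exact_mod_cast hm)
  have hss : Real.sqrt m ^ 2 = m := Real.sq_sqrt (by positivity)
  have key : binMean m (fun j => Real.exp (t * stdz m j)) = Real.cosh (t / Real.sqrt m) ^ m := by
    rw [Real.cosh_eq, div_pow, binMean, add_comm (Real.exp _), add_pow]
    congr 1
    refine sum_congr rfl fun j hj => ?_
    have hj' : j ≤ m := by simpa [Nat.lt_succ_iff] using hj
    rw [← Real.exp_nat_mul, ← Real.exp_nat_mul, ← Real.exp_add, mul_comm, Nat.cast_sub hj', stdz]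
    congr 2
    field_simp
    ring
  rw [key]
  refine (pow_le_pow_left₀ (Real.cosh_pos _).le (Real.cosh_le_exp_half_sq _) m).trans (le_of_eq ?_)
  rw [← Real.exp_nat_mul]
  congr 1
  rw [div_pow, hss]
  have : (m : ℝ) ≠ 0 := by positivity
  field_simp

/-- Completing the square writes `exp(y²/4)` as a Gaussian mixture of exponentials linear in `y`, so
bounds on the moment generating function pass to exponential moments of the square. -/
theorem integral_exp_neg_sq_add_mul (y : ℝ) :
    ∫ x : ℝ, Real.exp (-x ^ 2 + x * y) = Real.sqrt Real.pi * Real.exp (y ^ 2 / 4) := by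
  have h1 : (fun x : ℝ => Real.exp (-x ^ 2 + x * y)) =
      fun x => Real.exp (y ^ 2 / 4) * Real.exp (-1 * (x - y / 2) ^ 2) := by
    ext x
    rw [← Real.exp_add]
    congr 1
    ring
  rw [h1, MeasureTheory.integral_const_mul,
    MeasureTheory.integral_sub_right_eq_self (fun x => Real.exp (-1 * x ^ 2)), integral_gaussian]
  simp [mul_comm]

theorem integrable_exp_neg_sq_add_mul (y : ℝ) :
    MeasureTheory.Integrable (fun x : ℝ => Real.exp (-x ^ 2 + x * y)) := by
  have h1 : (fun x : ℝ => Real.exp (-x ^ 2 + x * y)) =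
      fun x => Real.exp (y ^ 2 / 4) * Real.exp (-1 * (x - y / 2) ^ 2) := by
    ext x
    rw [← Real.exp_add]
    congr 1
    ring
  rw [h1]
  exact ((integrable_exp_neg_mul_sq one_pos).comp_sub_right (y / 2)).const_mul _

/-- The square of a standardised binomial variable has an exponential moment. -/
theorem binMean_exp_sq_le {m : ℕ} (hm : 0 < m) :
    binMean m (fun j => Real.exp (stdz m j ^ 2 / 4)) ≤ Real.sqrt 2 := by
  have hpi : 0 < Real.sqrt Real.pi := Real.sqrt_pos.2 Real.pi_pos
  have h1 : Real.sqrt Real.pi * binMean m (fun j => Real.exp (stdz m j ^ 2 / 4)) =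
      ∫ x : ℝ, binMean m (fun j => Real.exp (-x ^ 2 + x * stdz m j)) := by
    rw [← binMean_mul_left]
    simp_rw [← integral_exp_neg_sq_add_mul]
    unfold binMean
    rw [MeasureTheory.integral_div, MeasureTheory.integral_finsetSum]
    · simp_rw [MeasureTheory.integral_const_mul]
    · exact fun j _ => (integrable_exp_neg_sq_add_mul _).const_mul _
  have h2 : ∫ x : ℝ, binMean m (fun j => Real.exp (-x ^ 2 + x * stdz m j)) ≤
      ∫ x : ℝ, Real.exp (-(1 / 2) * x ^ 2) := by
    refine MeasureTheory.integral_mono ?_ (integrable_exp_neg_mul_sq (by norm_num)) fun x => ?_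
    · unfold binMean
      exact (MeasureTheory.integrable_finsetSum _
        fun j _ => (integrable_exp_neg_sq_add_mul _).const_mul _).div_const _
    · have h3 : binMean m (fun j => Real.exp (-x ^ 2 + x * stdz m j)) =
          Real.exp (-x ^ 2) * binMean m (fun j => Real.exp (x * stdz m j)) := by
        rw [← binMean_mul_left]
        simp_rw [Real.exp_add]
      change binMean m (fun j => Real.exp (-x ^ 2 + x * stdz m j)) ≤ _
      rw [h3]
      refine (mul_le_mul_of_nonneg_left (binMean_exp_le hm x) (Real.exp_pos _).le).trans
        (le_of_eq ?_)
      rw [← Real.exp_add]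
      congr 1
      ring
  rw [integral_gaussian] at h2
  have h4 : Real.sqrt (Real.pi / (1 / 2)) = Real.sqrt Real.pi * Real.sqrt 2 := by
    rw [← Real.sqrt_mul Real.pi_pos.le]
    congr 1
    ring
  rw [h4, ← h1] at h2
  exact le_of_mul_le_mul_left h2 hpi

theorem binMean_exp_sq_le' {m : ℕ} (hm : 0 < m) {c : ℝ} (hc : c ≤ 1 / 4) :
    binMean m (fun j => Real.exp (c * stdz m j ^ 2)) ≤ 3 / 2 := by
  refine (binMean_mono fun j _ => ?_).trans ((binMean_exp_sq_le hm).trans ?_)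
  · exact Real.exp_le_exp.2 (by nlinarith [sq_nonneg (stdz m j)])
  · rw [Real.sqrt_le_left (by norm_num)]
    norm_num

/-! ### Lower bounds for binomial coefficients -/

/-- The squared form of `4^N ≤ 2√N · C(2N,N)` with `N = n + 1`; the induction step comes down to
`4N(N+1) ≤ (2N+1)²`. -/
theorem sixteen_pow_le_centralBinom_sq (n : ℕ) :
    (16 : ℝ) ^ (n + 1) ≤ 4 * (n + 1) * (Nat.centralBinom (n + 1) : ℝ) ^ 2 := by
  induction n with
  | zero => norm_num [Nat.centralBinom]
  | succ n ih =>
    have h := Nat.succ_mul_centralBinom_succ (n + 1)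
    have h' : ((n : ℝ) + 2) * (Nat.centralBinom (n + 2) : ℝ) =
        2 * (2 * (n + 1) + 1) * (Nat.centralBinom (n + 1) : ℝ) := by
      have := congrArg (Nat.cast (R := ℝ)) h
      push_cast at this
      linarith
    set a := (Nat.centralBinom (n + 1) : ℝ)
    set b := (Nat.centralBinom (n + 2) : ℝ)
    have hn : (0 : ℝ) ≤ n := by positivity
    have h2 : ((n : ℝ) + 2) ^ 2 * b ^ 2 = 4 * (2 * (n + 1) + 1) ^ 2 * a ^ 2 := by
      rw [← mul_pow, h']; ring
    have h3 : (n + 1) * ((n : ℝ) + 2) * (16 : ℝ) ^ (n + 1 + 1) ≤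
        (n + 1) * ((n : ℝ) + 2) * (4 * (n + 2) * b ^ 2) := by
      have : (n + 1) * ((n : ℝ) + 2) * (4 * (n + 2) * b ^ 2) =
        4 * (n + 1) * (4 * (2 * (n + 1) + 1) ^ 2 * a ^ 2) := by rw [← h2]; ring
      rw [this, pow_succ]
      have h5 : (n + 1) * ((n : ℝ) + 2) * (16 ^ (n + 1) * 16) ≤
          (n + 1) * ((n : ℝ) + 2) * ((4 * (n + 1) * a ^ 2) * 16) := by gcongr
      refine h5.trans ?_
      have : 0 ≤ a ^ 2 := sq_nonneg a
      nlinarith [mul_nonneg hn this]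
    have := le_of_mul_le_mul_left h3 (by positivity)
    push_cast
    linarith

theorem two_pow_le_sqrt_mul_choose_half {m : ℕ} (hm : 0 < m) :
    (2 : ℝ) ^ m ≤ 2 * Real.sqrt m * (m.choose (m / 2) : ℝ) := by
  have h0 : (0 : ℝ) ≤ 2 * Real.sqrt m * (m.choose (m / 2) : ℝ) := by positivity
  refine le_of_sq_le_sq ?_ h0
  rw [mul_pow, mul_pow, Real.sq_sqrt (by positivity)]
  rcases Nat.even_or_odd' m with ⟨n, rfl | rfl⟩
  · obtain ⟨n, rfl⟩ : ∃ l, n = l + 1 := ⟨n - 1, by omega⟩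
    have h := sixteen_pow_le_centralBinom_sq n
    rw [Nat.mul_div_cancel_left _ (by norm_num : 0 < 2)]
    rw [Nat.centralBinom] at h
    have e : ((2 : ℝ) ^ (2 * (n + 1))) ^ 2 = 16 ^ (n + 1) := by
      rw [← pow_mul, mul_comm 2 (n + 1), mul_assoc, mul_comm, pow_mul]; norm_num
    rw [e]
    have : (0 : ℝ) ≤ ((2 * (n + 1)).choose (n + 1) : ℝ) ^ 2 := by positivity
    push_cast at h ⊢
    nlinarith
  · have h := sixteen_pow_le_centralBinom_sq n
    have hd : (2 * n + 1) / 2 = n := by omega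
    rw [hd]
    have hc : (Nat.centralBinom (n + 1) : ℝ) = 2 * ((2 * n + 1).choose n : ℝ) := by
      have : Nat.centralBinom (n + 1) = 2 * (2 * n + 1).choose n := by
        rw [Nat.centralBinom, show 2 * (n + 1) = (2 * n + 1) + 1 by ring, Nat.choose_succ_succ]
        rw [Nat.succ_eq_add_one, Nat.choose_symm_half]
        ring
      exact_mod_cast this
    rw [hc] at h
    have e : 4 * ((2 : ℝ) ^ (2 * n + 1)) ^ 2 = 16 ^ (n + 1) := by
      rw [← pow_mul, show (2 * n + 1) * 2 = 4 * n + 2 by ring, pow_add, pow_mul, pow_succ]; norm_num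
      ring
    have : (0 : ℝ) ≤ ((2 * n + 1).choose n : ℝ) ^ 2 := by positivity
    push_cast at h ⊢
    nlinarith [(by positivity : (0 : ℝ) ≤ n)]

/-- Induction outward from the centre. One step costs the ratio `(j+1)/(m-j)`, at least
`exp(-(4(m-2j)-4)/m)`, and these exponents telescope because `s² - (s-2)² = 4s - 4`. -/
theorem choose_ge_left {m : ℕ} (d : ℕ) : ∀ j : ℕ, j + d = m / 2 → 4 * (m - 2 * j) ≤ m →
    (m.choose (m / 2) : ℝ) * Real.exp (-((m : ℝ) - 2 * j) ^ 2 / m) ≤ (m.choose j : ℝ) := by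
  induction d with
  | zero =>
    intro j hj _
    have : j = m / 2 := by omega
    subst this
    refine mul_le_of_le_one_right (by positivity) (Real.exp_le_one_iff.2 ?_)
    exact div_nonpos_of_nonpos_of_nonneg (by nlinarith [sq_nonneg ((m : ℝ) - 2 * ((m / 2 : ℕ) : ℝ))])
      (by positivity)
  | succ d ih =>
    intro j hj h4
    have hm : 0 < m := by omega
    have ih' := ih (j + 1) (by omega) (by omega)
    have hjm : 2 * (j + 1) ≤ m := by omega
    have hjR : 2 * ((j : ℝ) + 1) ≤ m := by exact_mod_cast hjm
    have hmR : (0 : ℝ) < m := by exact_mod_cast hm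
    have h4R : 4 * ((m : ℝ) - 2 * j) ≤ m := by
      have h5 : 4 * m ≤ m + 8 * j := by omega
      have : (4 * m : ℝ) ≤ m + 8 * j := by exact_mod_cast h5
      linarith
    have hrec : (m.choose (j + 1) : ℝ) * (j + 1) = (m.choose j : ℝ) * (m - j) := by
      have := congrArg (Nat.cast (R := ℝ)) (Nat.choose_succ_right_eq m j)
      push_cast [Nat.cast_sub (by omega : j ≤ m)] at this
      exact this
    have hmj : (0 : ℝ) < m - j := by linarith [(by positivity : (0 : ℝ) ≤ j)]
    have hchoose : (m.choose j : ℝ) = (m.choose (j + 1) : ℝ) * ((j + 1) / (m - j)) := by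
      field_simp
      linarith
    have hexp : Real.exp (-(4 * ((m : ℝ) - 2 * j) - 4) / m) ≤ (j + 1) / (m - j) := by
      have hz : (0 : ℝ) < (j + 1) / (m - j) := by positivity
      rw [← Real.le_log_iff_exp_le hz]
      refine le_trans ?_ (Real.one_sub_inv_le_log_of_pos hz)
      rw [inv_div, div_le_iff₀ hmR]
      have h6 : 1 - ((m : ℝ) - j) / (j + 1) = -((m - 2 * j - 1) / (j + 1)) := by
        field_simp; ring
      rw [h6]
      -- Closeness to the centre enters only here, through `m ≤ 4(j+1)`.
      have h7 : ((m : ℝ) - 2 * j - 1) / (j + 1) * m ≤ 4 * (m - 2 * j - 1) := by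
        rw [div_mul_eq_mul_div, div_le_iff₀ (by positivity)]
        nlinarith
      linarith
    rw [hchoose]
    calc (m.choose (m / 2) : ℝ) * Real.exp (-((m : ℝ) - 2 * j) ^ 2 / m)
        = ((m.choose (m / 2) : ℝ) * Real.exp (-((m : ℝ) - 2 * ((j + 1 : ℕ) : ℝ)) ^ 2 / m)) *
          Real.exp (-(4 * ((m : ℝ) - 2 * j) - 4) / m) := by
          rw [mul_assoc, ← Real.exp_add]
          congr 2
          push_cast
          field_simp
          ring
      _ ≤ _ := by gcongr

/-- A local lower bound for the binomial distribution near its centre. -/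
theorem choose_ge {m j : ℕ} (hm : 0 < m) (hj : j ≤ m) (h4 : 4 * |(m : ℝ) - 2 * j| ≤ m) :
    Real.exp (-stdz m j ^ 2) / (2 * Real.sqrt m) ≤ (m.choose j : ℝ) / 2 ^ m := by
  have hs : 0 < Real.sqrt m := Real.sqrt_pos.2 (by exact_mod_cast hm)
  have main : ∀ i : ℕ, 2 * i ≤ m → 4 * |(m : ℝ) - 2 * i| ≤ m →
      Real.exp (-stdz m i ^ 2) / (2 * Real.sqrt m) ≤ (m.choose i : ℝ) / 2 ^ m := by
    intro i hi h4
    have h4' : 4 * (m - 2 * i) ≤ m := by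
      have h5 := (le_abs_self ((m : ℝ) - 2 * i))
      have h6 : (4 * m : ℝ) ≤ m + 8 * i := by linarith
      have : 4 * m ≤ m + 8 * i := by exact_mod_cast h6
      omega
    have h1 := choose_ge_left (m := m) (m / 2 - i) i (by omega) h4'
    have h2 := two_pow_le_sqrt_mul_choose_half hm
    have e : -((m : ℝ) - 2 * i) ^ 2 / m = -stdz m i ^ 2 := by
      rw [stdz, div_pow, Real.sq_sqrt (by positivity), neg_div]
    rw [e] at h1
    rw [div_le_div_iff₀ (by positivity) (by positivity)]
    calc Real.exp (-stdz m i ^ 2) * 2 ^ m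
        ≤ Real.exp (-stdz m i ^ 2) * (2 * Real.sqrt m * (m.choose (m / 2) : ℝ)) := by gcongr
      _ = ((m.choose (m / 2) : ℝ) * Real.exp (-stdz m i ^ 2)) * (2 * Real.sqrt m) := by ring
      _ ≤ _ := by gcongr
  by_cases h : 2 * j ≤ m
  · exact main j h h4
  · have := main (m - j) (by omega) (by
      rw [Nat.cast_sub hj, show (m : ℝ) - 2 * (m - j) = -(m - 2 * j) by ring, abs_neg]
      exact h4)
    rwa [stdz_reflect hj, neg_sq, Nat.choose_symm hj] at this

end IsingSQ

namespace IsingSQ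

open Finset

/-- A window of length `w` contains at least `w√m/4` lattice points, and each carries mass at least
`exp(-R²)/(2√m)` by `choose_ge`. -/
theorem exists_finset_mass_ge {m : ℕ} (hm : 0 < m) {R w y₀ : ℝ} (hw : 0 < w) (hwR : w ≤ R)
    (hy : |y₀| ≤ R) (h8 : 8 ≤ w * Real.sqrt m) (hR : 4 * R ≤ Real.sqrt m) :
    ∃ I : Finset ℕ, I ⊆ range (m + 1) ∧ (∀ j ∈ I, |stdz m j - y₀| ≤ w ∧ |stdz m j| ≤ R) ∧
      w / 8 * Real.exp (-R ^ 2) ≤ (∑ j ∈ I, (m.choose j : ℝ)) / 2 ^ m := by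
  have hs : 0 < Real.sqrt m := Real.sqrt_pos.2 (by exact_mod_cast hm)
  have hss : Real.sqrt m * Real.sqrt m = m := Real.mul_self_sqrt (by positivity)
  obtain ⟨hy1, hy2⟩ := abs_le.1 hy
  -- The window extends from `y₀` towards the origin, so that it stays inside `[-R, R]`.
  obtain ⟨a, b, hab, ha, hb, ha', hb'⟩ : ∃ a b : ℝ, b - a = w ∧ -R ≤ a ∧ b ≤ R ∧
      y₀ - w ≤ a ∧ b ≤ y₀ + w := by
    rcases le_total 0 y₀ with h | h
    · exact ⟨y₀ - w, y₀, by ring, by linarith, hy2, le_rfl, by linarith⟩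
    · exact ⟨y₀, y₀ + w, by ring, hy1, by linarith, by linarith, le_rfl⟩
  have hbs : b * Real.sqrt m ≤ R * Real.sqrt m := by gcongr
  have has : -R * Real.sqrt m ≤ a * Real.sqrt m := by gcongr
  have habs : b * Real.sqrt m - a * Real.sqrt m = w * Real.sqrt m := by rw [← hab]; ring
  have hRs : 4 * (R * Real.sqrt m) ≤ m := by nlinarith
  set α := ((m : ℝ) - b * Real.sqrt m) / 2 with hα
  set β := ((m : ℝ) - a * Real.sqrt m) / 2 with hβ
  have hα0 : 0 ≤ α := by
    have : (0 : ℝ) ≤ m := by positivity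
    linarith
  have hβ0 : 0 ≤ β := by linarith
  have key : ∀ j ∈ Icc ⌈α⌉₊ ⌊β⌋₊, a ≤ stdz m j ∧ stdz m j ≤ b := by
    intro j hj
    rw [mem_Icc] at hj
    have h1 : α ≤ j := Nat.ceil_le.1 hj.1
    have h2 : (j : ℝ) ≤ β := (Nat.le_floor_iff hβ0).1 hj.2
    unfold stdz
    rw [le_div_iff₀ hs, div_le_iff₀ hs]
    constructor <;> linarith
  have hjm : ∀ j ∈ Icc ⌈α⌉₊ ⌊β⌋₊, j ≤ m := by
    intro j hj
    rw [mem_Icc] at hj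
    have h2 : (j : ℝ) ≤ β := (Nat.le_floor_iff hβ0).1 hj.2
    have : (j : ℝ) ≤ m := by linarith [(by positivity : (0 : ℝ) ≤ m)]
    exact_mod_cast this
  have hR' : ∀ j ∈ Icc ⌈α⌉₊ ⌊β⌋₊, |stdz m j| ≤ R := fun j hj => by
    obtain ⟨h1, h2⟩ := key j hj
    exact abs_le.2 ⟨by linarith, by linarith⟩
  refine ⟨Icc ⌈α⌉₊ ⌊β⌋₊, fun j hj => mem_range.2 (Nat.lt_succ_of_le (hjm j hj)),
    fun j hj => ⟨?_, hR' j hj⟩, ?_⟩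
  · obtain ⟨h1, h2⟩ := key j hj
    exact abs_le.2 ⟨by linarith, by linarith⟩
  · have hcard : w * Real.sqrt m / 4 ≤ ((Icc ⌈α⌉₊ ⌊β⌋₊).card : ℝ) := by
      have h1 := Nat.lt_floor_add_one β
      have h2 := Nat.ceil_lt_add_one hα0
      have h3 : ⌊β⌋₊ + 1 ≤ (Icc ⌈α⌉₊ ⌊β⌋₊).card + ⌈α⌉₊ := by
        rw [Nat.card_Icc]; omega
      have h3' : (⌊β⌋₊ : ℝ) + 1 ≤ ((Icc ⌈α⌉₊ ⌊β⌋₊).card : ℝ) + ⌈α⌉₊ := by exact_mod_cast h3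
      linarith
    have hterm : ∀ j ∈ Icc ⌈α⌉₊ ⌊β⌋₊,
        Real.exp (-R ^ 2) / (2 * Real.sqrt m) ≤ (m.choose j : ℝ) / 2 ^ m := by
      intro j hj
      have hab := hR' j hj
      refine le_trans ?_ (choose_ge hm (hjm j hj) ?_)
      · exact div_le_div_of_nonneg_right (Real.exp_le_exp.2
          (neg_le_neg (sq_le_sq' (abs_le.1 hab).1 (abs_le.1 hab).2))) (by positivity)
      · have : |(m : ℝ) - 2 * j| = |stdz m j| * Real.sqrt m := by
          rw [stdz, abs_div, abs_of_pos hs]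
          field_simp
        rw [this]
        have : |stdz m j| * Real.sqrt m ≤ R * Real.sqrt m := by gcongr
        linarith
    rw [sum_div]
    have := card_nsmul_le_sum _ _ _ hterm
    rw [nsmul_eq_mul] at this
    refine le_trans ?_ this
    calc w / 8 * Real.exp (-R ^ 2) = (w * Real.sqrt m / 4) *
          (Real.exp (-R ^ 2) / (2 * Real.sqrt m)) := by field_simp; ring
      _ ≤ _ := by gcongr

/-! ### The density of the number of ones in a clique of the Ising model -/

/-- The normalising constant of `cliqueDensity`. -/
noncomputable def cliqueNorm (m : ℕ) (δ : ℝ) : ℝ :=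
  binMean m (fun j => Real.exp (δ * stdz m j ^ 2 / 2))

/-- The density, relative to `Bin(m, 1/2)`, of the number of ones in the clique of the Ising
model with interactions `δ/m`. -/
noncomputable def cliqueDensity (m : ℕ) (δ : ℝ) (j : ℕ) : ℝ :=
  Real.exp (δ * stdz m j ^ 2 / 2) / cliqueNorm m δ

/-- Keeps the factor `δ` explicit and pays with an exponential growing slowly enough to be
integrable against the binomial. It follows from `e^s - 1 ≤ s·e^s`. -/
theorem exp_sub_one_le {δ : ℝ} (h0 : 0 ≤ δ) (h1 : δ ≤ 1 / 32) (y : ℝ) :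
    Real.exp (δ * y ^ 2 / 2) - 1 ≤ 32 * δ * Real.exp (y ^ 2 / 32) := by
  have hy := sq_nonneg y
  have h2 : Real.exp (δ * y ^ 2 / 2) - 1 ≤ (δ * y ^ 2 / 2) * Real.exp (δ * y ^ 2 / 2) := by
    have h := Real.add_one_le_exp (-(δ * y ^ 2 / 2))
    have h' := mul_le_mul_of_nonneg_right h (Real.exp_pos (δ * y ^ 2 / 2)).le
    rw [← Real.exp_add, neg_add_cancel, Real.exp_zero] at h'
    linarith
  have h3 : y ^ 2 / 64 ≤ Real.exp (y ^ 2 / 64) := by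
    linarith [Real.add_one_le_exp (y ^ 2 / 64)]
  have h4 : Real.exp (δ * y ^ 2 / 2) ≤ Real.exp (y ^ 2 / 64) :=
    Real.exp_le_exp.2 (by nlinarith)
  calc _ ≤ (δ * y ^ 2 / 2) * Real.exp (δ * y ^ 2 / 2) := h2
    _ = 32 * δ * ((y ^ 2 / 64) * Real.exp (δ * y ^ 2 / 2)) := by ring
    _ ≤ 32 * δ * (Real.exp (y ^ 2 / 64) * Real.exp (y ^ 2 / 64)) := by gcongr
    _ = _ := by rw [← Real.exp_add]; ring_nf

theorem one_le_cliqueNorm (m : ℕ) {δ : ℝ} (h0 : 0 ≤ δ) : 1 ≤ cliqueNorm m δ := by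
  rw [← binMean_const m 1]
  exact binMean_mono fun j _ => Real.one_le_exp (by positivity)

theorem cliqueNorm_le {m : ℕ} (hm : 0 < m) {δ : ℝ} (h0 : 0 ≤ δ) (h1 : δ ≤ 1 / 32) :
    cliqueNorm m δ ≤ 1 + 48 * δ := by
  have h2 : cliqueNorm m δ ≤
      binMean m (fun j => 1 + (32 * δ) * Real.exp (1 / 32 * stdz m j ^ 2)) := by
    refine binMean_mono fun j _ => ?_
    have := exp_sub_one_le h0 h1 (stdz m j)
    rw [one_div_mul_eq_div]
    linarith
  rw [binMean_add, binMean_const, binMean_mul_left] at h2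
  have := binMean_exp_sq_le' hm (c := 1 / 32) (by norm_num)
  nlinarith

theorem abs_cliqueDensity_sub_one_le {m : ℕ} (hm : 0 < m) {δ : ℝ} (h0 : 0 ≤ δ) (h1 : δ ≤ 1 / 32)
    (j : ℕ) : |cliqueDensity m δ j - 1| ≤ 80 * δ * Real.exp (stdz m j ^ 2 / 32) := by
  have hZ1 := one_le_cliqueNorm m h0
  have hZ2 := cliqueNorm_le hm h0 h1
  have hZ : 0 < cliqueNorm m δ := by linarith
  have he := exp_sub_one_le h0 h1 (stdz m j)
  have he1 : 1 ≤ Real.exp (δ * stdz m j ^ 2 / 2) := Real.one_le_exp (by positivity)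
  have he2 : 1 ≤ Real.exp (stdz m j ^ 2 / 32) := Real.one_le_exp (by positivity)
  have hc : cliqueDensity m δ j - 1 =
      (Real.exp (δ * stdz m j ^ 2 / 2) - cliqueNorm m δ) / cliqueNorm m δ := by
    unfold cliqueDensity; field_simp
  rw [hc, abs_div, abs_of_pos hZ]
  refine (div_le_self (abs_nonneg _) hZ1).trans ?_
  have h48 : 48 * δ ≤ 48 * δ * Real.exp (stdz m j ^ 2 / 32) :=
    le_mul_of_one_le_right (by positivity) he2
  have hp : 0 ≤ δ * Real.exp (stdz m j ^ 2 / 32) := by positivity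
  rw [abs_le]
  constructor <;> nlinarith

/-- Leaves room for a correction of size `1/2` that keeps the density nonnegative. -/
theorem half_le_cliqueDensity {m : ℕ} (hm : 0 < m) {δ : ℝ} (h0 : 0 ≤ δ) (h1 : δ ≤ 1 / 48)
    (j : ℕ) : 1 / 2 ≤ cliqueDensity m δ j := by
  have hZ1 := one_le_cliqueNorm m h0
  have hZ2 := cliqueNorm_le hm h0 (by linarith)
  have he1 : 1 ≤ Real.exp (δ * stdz m j ^ 2 / 2) := Real.one_le_exp (by positivity)
  unfold cliqueDensity
  rw [div_le_div_iff₀ (by norm_num) (by linarith)]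
  linarith

theorem binMean_cliqueDensity {m : ℕ} {δ : ℝ} (h0 : 0 ≤ δ) :
    binMean m (cliqueDensity m δ) = 1 := by
  have hZ1 := one_le_cliqueNorm m h0
  have : cliqueDensity m δ =
      fun j => (cliqueNorm m δ)⁻¹ * Real.exp (δ * stdz m j ^ 2 / 2) := by
    ext j; unfold cliqueDensity; rw [div_eq_inv_mul]
  rw [this, binMean_mul_left]
  exact inv_mul_cancel₀ (by linarith)

theorem binMean_abs_cliqueDensity_sub_one_le {m : ℕ} (hm : 0 < m) {δ : ℝ} (h0 : 0 ≤ δ)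
    (h1 : δ ≤ 1 / 32) : binMean m (fun j => |cliqueDensity m δ j - 1|) ≤ 120 * δ := by
  refine (binMean_mono fun j _ => abs_cliqueDensity_sub_one_le hm h0 h1 j).trans ?_
  rw [binMean_mul_left]
  have := binMean_exp_sq_le' hm (c := 1 / 32) (by norm_num)
  simp only [one_div_mul_eq_div] at this
  nlinarith

theorem binMean_cliqueDensity_sub_one_sq_le {m : ℕ} (hm : 0 < m) {δ : ℝ} (h0 : 0 ≤ δ)
    (h1 : δ ≤ 1 / 32) : binMean m (fun j => (cliqueDensity m δ j - 1) ^ 2) ≤ 300 * δ := by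
  have h2 : ∀ j ≤ m, (cliqueDensity m δ j - 1) ^ 2 ≤
      (6400 * δ ^ 2) * Real.exp (1 / 16 * stdz m j ^ 2) := by
    intro j _
    have := abs_cliqueDensity_sub_one_le hm h0 h1 j
    rw [← sq_abs]
    refine (pow_le_pow_left₀ (abs_nonneg _) this 2).trans (le_of_eq ?_)
    rw [mul_pow, ← Real.exp_nat_mul]
    ring_nf
  refine (binMean_mono h2).trans ?_
  rw [binMean_mul_left]
  have := binMean_exp_sq_le' hm (c := 1 / 16) (by norm_num)
  have h3 : 6400 * δ ^ 2 ≤ 200 * δ := by nlinarith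
  nlinarith [(by positivity : 0 ≤ δ ^ 2)]

/-- The weight `y²·exp(y²/16)` is the growth allowed to even Chebyshev polynomials in
`abs_eval_T_even_sub_le_exp`. -/
theorem binMean_abs_cliqueDensity_mul_le {m : ℕ} (hm : 0 < m) {δ : ℝ} (h0 : 0 ≤ δ)
    (h1 : δ ≤ 1 / 32) :
    binMean m (fun j => |cliqueDensity m δ j - 1| *
      (stdz m j ^ 2 * Real.exp (stdz m j ^ 2 / 16))) ≤ 1920 * δ := by
  have h2 : ∀ j ≤ m, |cliqueDensity m δ j - 1| * (stdz m j ^ 2 * Real.exp (stdz m j ^ 2 / 16)) ≤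
      (1280 * δ) * Real.exp (5 / 32 * stdz m j ^ 2) := by
    intro j _
    have h3 : stdz m j ^ 2 ≤ 16 * Real.exp (stdz m j ^ 2 / 16) := by
      linarith [Real.add_one_le_exp (stdz m j ^ 2 / 16)]
    calc _ ≤ (80 * δ * Real.exp (stdz m j ^ 2 / 32)) *
          ((16 * Real.exp (stdz m j ^ 2 / 16)) * Real.exp (stdz m j ^ 2 / 16)) := by
          gcongr
          exact abs_cliqueDensity_sub_one_le hm h0 h1 j
      _ = (1280 * δ) * (Real.exp (stdz m j ^ 2 / 32) *
          (Real.exp (stdz m j ^ 2 / 16) * Real.exp (stdz m j ^ 2 / 16))) := by ring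
      _ = _ := by rw [← Real.exp_add, ← Real.exp_add]; ring_nf
  refine (binMean_mono h2).trans ?_
  rw [binMean_mul_left]
  have := binMean_exp_sq_le' hm (c := 5 / 32) (by norm_num)
  nlinarith

theorem cliqueDensity_reflect {m j : ℕ} (δ : ℝ) (hj : j ≤ m) :
    cliqueDensity m δ (m - j) = cliqueDensity m δ j := by
  unfold cliqueDensity
  rw [stdz_reflect hj, neg_sq]

end IsingSQ

/-! ### Chebyshev polynomials: Lipschitz bounds, growth and coefficients. -/

namespace IsingSQ

open Finset Polynomial Polynomial.Chebyshev

/-- On `[-1,1]` the derivative of `T_n` is largest in absolute value at `1`, where it equals `n²`.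
-/
theorem abs_eval_T_sub_le (n : ℕ) {x y : ℝ} (hx : |x| ≤ 1) (hy : |y| ≤ 1) :
    |(T ℝ n).eval x - (T ℝ n).eval y| ≤ (n : ℝ) ^ 2 * |x - y| := by
  have hbound : ∀ z ∈ Set.Icc (-1 : ℝ) 1, ‖(derivative (T ℝ n)).eval z‖ ≤ (n : ℝ) ^ 2 := by
    intro z hz
    have h := abs_iterate_derivative_T_real_le n 1 (abs_le.2 hz)
    simp only [Function.iterate_one] at h
    rw [derivative_T_eval_one] at h
    simpa using h
  have := (convex_Icc (-1 : ℝ) 1).norm_image_sub_le_of_norm_hasDerivWithin_le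
    (f := fun z => (T ℝ n).eval z) (fun z _ => ((T ℝ n).hasDerivAt z).hasDerivWithinAt) hbound
    (abs_le.1 hy) (abs_le.1 hx)
  simpa using this

theorem eval_T_succ_le (n : ℕ) {x : ℝ} (hx : 1 ≤ x) :
    (T ℝ ((n + 1 : ℕ) : ℤ)).eval x ≤ 2 * x * (T ℝ (n : ℤ)).eval x := by
  have h0 := one_le_eval_T_real ((n : ℤ) - 1) hx
  have h := congrArg (Polynomial.eval x) (T_add_one ℝ (n : ℤ))
  simp only [eval_sub, eval_mul, eval_ofNat, eval_X] at h
  push_cast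
  linarith

theorem eval_T_le_pow (n : ℕ) {x : ℝ} (hx : 1 ≤ x) : (T ℝ (n : ℤ)).eval x ≤ (2 * x) ^ n := by
  induction n with
  | zero => simp
  | succ n ih =>
    refine (eval_T_succ_le n hx).trans ?_
    rw [pow_succ, mul_comm]
    gcongr

theorem abs_eval_T_le_pow (n : ℕ) {x : ℝ} (hx : 1 ≤ |x|) :
    |(T ℝ (n : ℤ)).eval x| ≤ (2 * |x|) ^ n := by
  have h : |(T ℝ (n : ℤ)).eval x| = (T ℝ (n : ℤ)).eval |x| := by
    have h1 := one_le_eval_T_real (n : ℤ) hx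
    rcases abs_choice x with h | h
    · rw [h] at h1 ⊢
      exact abs_of_nonneg (by linarith)
    · rw [h] at h1 ⊢
      rw [T_eval_neg] at h1 ⊢
      have h2 : |(((n : ℤ).negOnePow : ℤˣ) : ℝ)| = 1 := by
        rcases Int.units_eq_one_or ((n : ℤ).negOnePow) with h | h <;> simp [h]
      rw [← abs_of_nonneg (by linarith : (0 : ℝ) ≤ _ * (T ℝ (n : ℤ)).eval x), abs_mul, h2, one_mul]
  rw [h]
  exact eval_T_le_pow n hx

/-- `T_{2l}(z) = T_l(2z² - 1)`, so the Lipschitz bound for `T_l` becomes quadratic in `z` at the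
origin. -/
theorem abs_eval_T_even_sub_le (l : ℕ) {x : ℝ} (hx : |x| ≤ 1) :
    |(T ℝ ((2 * l : ℕ) : ℤ)).eval x - (T ℝ ((2 * l : ℕ) : ℤ)).eval 0| ≤
      ((2 * l : ℕ) : ℝ) ^ 2 * x ^ 2 := by
  have hT : ∀ z : ℝ, (T ℝ ((2 * l : ℕ) : ℤ)).eval z = (T ℝ (l : ℤ)).eval (2 * z ^ 2 - 1) := by
    intro z
    rw [show ((2 * l : ℕ) : ℤ) = (l : ℤ) * 2 by push_cast; ring, T_mul, eval_comp, T_two]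
    simp
  have hx2 : x ^ 2 ≤ 1 := (sq_le_one_iff_abs_le_one x).2 hx
  have h0 := sq_nonneg x
  rw [hT, hT]
  refine (abs_eval_T_sub_le l (abs_le.2 ⟨by linarith, by linarith⟩) (by norm_num)).trans ?_
  rw [show 2 * x ^ 2 - 1 - (2 * 0 ^ 2 - 1) = 2 * x ^ 2 by ring, abs_of_nonneg (by positivity)]
  push_cast
  nlinarith [(by positivity : 0 ≤ (l : ℝ) ^ 2 * x ^ 2)]

/-- An even Chebyshev polynomial, stretched to `[-R, R]`, is flat near the origin and grows slowly
outside of `[-R, R]`. -/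
theorem abs_eval_T_even_sub_le_exp {n k : ℕ} (hn : Even n) (hnk : n ≤ k) {R : ℝ} (hR0 : 0 < R)
    (hR : 16 * (k : ℝ) ≤ R ^ 2) (y : ℝ) :
    |(T ℝ (n : ℤ)).eval (y / R) - (T ℝ (n : ℤ)).eval 0| ≤
      2 * (n : ℝ) ^ 2 / R ^ 2 * (y ^ 2 * Real.exp (y ^ 2 / 16)) := by
  obtain ⟨l, hl⟩ := hn
  rw [← two_mul] at hl
  subst hl
  have he : 1 ≤ Real.exp (y ^ 2 / 16) := Real.one_le_exp (by positivity)
  have hrw : 2 * ((2 * l : ℕ) : ℝ) ^ 2 / R ^ 2 * (y ^ 2 * Real.exp (y ^ 2 / 16)) =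
      2 * (((2 * l : ℕ) : ℝ) ^ 2 * (y / R) ^ 2) * Real.exp (y ^ 2 / 16) := by
    rw [div_pow]; ring
  rw [hrw]
  have hxy : (y / R) ^ 2 * R ^ 2 = y ^ 2 := by field_simp
  set x := y / R
  rcases le_total |x| 1 with hx | hx
  · refine (abs_eval_T_even_sub_le l hx).trans ?_
    have h0 : 0 ≤ ((2 * l : ℕ) : ℝ) ^ 2 * x ^ 2 := by positivity
    nlinarith
  · rcases Nat.eq_zero_or_pos l with rfl | hl
    · simp
    have h1 := abs_eval_T_le_pow (2 * l) hx
    have h2 : |(T ℝ ((2 * l : ℕ) : ℤ)).eval 0| ≤ 1 :=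
      abs_eval_T_real_le_one _ (by norm_num)
    have hx2 : 1 ≤ x ^ 2 := (one_le_sq_iff_one_le_abs x).2 hx
    -- Outside the interval, `(2|x|)^n ≤ exp(n|x|) ≤ exp(kx²)`, which `16k ≤ R²` turns into
    -- `exp(y²/16)`.
    have h3 : 2 * |x| ≤ Real.exp |x| := by
      have := Real.quadratic_le_exp_of_nonneg (abs_nonneg x)
      nlinarith [sq_nonneg (|x| - 1)]
    have h4 : (2 * |x|) ^ (2 * l) ≤ Real.exp (y ^ 2 / 16) := by
      refine (pow_le_pow_left₀ (by positivity) h3 _).trans ?_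
      rw [← Real.exp_nat_mul]
      refine Real.exp_le_exp.2 ?_
      have h5 : |x| ≤ x ^ 2 := by
        rw [← sq_abs]; nlinarith
      have h6 : ((2 * l : ℕ) : ℝ) ≤ k := by exact_mod_cast hnk
      calc ((2 * l : ℕ) : ℝ) * |x| ≤ k * x ^ 2 := by gcongr
        _ ≤ (R ^ 2 / 16) * x ^ 2 := by gcongr; linarith
        _ = y ^ 2 / 16 := by rw [← hxy]; ring
    have hl2 : 1 ≤ ((2 * l : ℕ) : ℝ) ^ 2 := by
      have : (1 : ℝ) ≤ ((2 * l : ℕ) : ℝ) := by exact_mod_cast (by omega : 1 ≤ 2 * l)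
      nlinarith
    have h7 : 1 ≤ ((2 * l : ℕ) : ℝ) ^ 2 * x ^ 2 := one_le_mul_of_one_le_of_one_le hl2 hx2
    have h8 := abs_sub ((T ℝ ((2 * l : ℕ) : ℤ)).eval x) ((T ℝ ((2 * l : ℕ) : ℤ)).eval 0)
    have h9 : Real.exp (y ^ 2 / 16) ≤
        (((2 * l : ℕ) : ℝ) ^ 2 * x ^ 2) * Real.exp (y ^ 2 / 16) :=
      le_mul_of_one_le_left (by positivity) h7
    linarith

/-- The Chebyshev coefficients of a polynomial are at most twice its maximum on `[-1, 1]`. -/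
theorem abs_chebyshev_coeff_le {k : ℕ} (a : ℕ → ℝ) {B : ℝ}
    (hB : ∀ x : ℝ, |x| ≤ 1 → |∑ n ∈ range (k + 1), a n * (T ℝ (n : ℤ)).eval x| ≤ B)
    {l : ℕ} (hl : l ≤ k) : |a l| ≤ 2 * B := by
  set p : ℝ → ℝ := fun x => ∑ n ∈ range (k + 1), a n * (T ℝ (n : ℤ)).eval x with hp
  have hB0 : 0 ≤ B := (abs_nonneg _).trans (hB 0 (by norm_num))
  -- Orthogonality isolates `a l`. The weight has total mass `π` while `T_l²` integrates to at least
  -- `π/2`, whence the factor `2`.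
  have hint : ∫ x, p x * (T ℝ (l : ℤ)).eval x ∂measureT =
      a l * ∫ x, (T ℝ (l : ℤ)).eval x * (T ℝ (l : ℤ)).eval x ∂measureT := by
    simp only [hp, sum_mul]
    rw [MeasureTheory.integral_finsetSum _ fun i _ => integrable_measureT (by fun_prop)]
    simp only [mul_assoc, MeasureTheory.integral_const_mul]
    rw [sum_eq_single_of_mem l (mem_range.2 (by omega))]
    intro n _ hn
    rw [integral_eval_T_real_mul_eval_T_real_measureT_of_ne hn, mul_zero]
  have hpi := Real.pi_pos
  have hbound : |∫ x, p x * (T ℝ (l : ℤ)).eval x ∂measureT| ≤ B * Real.pi := by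
    rw [integral_measureT_eq_integral_cos]
    have := intervalIntegral.norm_integral_le_of_norm_le_const (a := 0) (b := Real.pi) (C := B)
      (f := fun θ => p (Real.cos θ) * (T ℝ (l : ℤ)).eval (Real.cos θ)) (fun θ _ => by
        rw [norm_mul, Real.norm_eq_abs, Real.norm_eq_abs]
        have h1 := hB (Real.cos θ) (Real.abs_cos_le_one θ)
        have h2 := abs_eval_T_real_le_one (l : ℤ) (Real.abs_cos_le_one θ)
        calc _ ≤ B * 1 := by gcongr
          _ = B := mul_one B)
    simpa [abs_of_pos hpi] using this
  have hself : Real.pi / 2 ≤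
      ∫ x, (T ℝ (l : ℤ)).eval x * (T ℝ (l : ℤ)).eval x ∂measureT := by
    rcases eq_or_ne l 0 with rfl | h
    · have := integral_eval_T_real_mul_self_measureT_zero
      rw [Nat.cast_zero, this]; linarith
    · rw [integral_T_real_mul_self_measureT_of_ne_zero h]
  rw [hint, abs_mul] at hbound
  have : |a l| * (Real.pi / 2) ≤ B * Real.pi :=
    (mul_le_mul_of_nonneg_left (hself.trans (le_abs_self _)) (abs_nonneg _)).trans hbound
  nlinarith

end IsingSQ

/-! ### Matching moments by a separation argument. -/

namespace IsingSQ

open Finset Polynomial Polynomial.Chebyshev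

/-- A vector lies in a linear image of a compact convex set as soon as no linear functional
separates it from that image. -/
theorem exists_mem_map_eq_of_forall_le {V ι : Type*} [Fintype ι] [AddCommGroup V] [Module ℝ V]
    [TopologicalSpace V] {K : Set V} (hc : IsCompact K) (hconv : Convex ℝ K)
    (Φ : V →ₗ[ℝ] (ι → ℝ)) (hΦ : Continuous Φ) (b : ι → ℝ)
    (h : ∀ a : ι → ℝ, ∃ f ∈ K, ∑ i, a i * b i ≤ ∑ i, a i * Φ f i) :
    ∃ f ∈ K, Φ f = b := by
  classical
  by_contra hne
  have hb : b ∉ Φ '' K := fun ⟨f, hf, hfb⟩ => hne ⟨f, hf, hfb⟩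
  obtain ⟨F, u, hF1, hF2⟩ := geometric_hahn_banach_closed_point (hconv.linear_image Φ)
    (hc.image hΦ).isClosed hb
  obtain ⟨f, hfK, hf⟩ := h fun i => F (Pi.single i 1)
  have hrep : ∀ z : ι → ℝ, F z = ∑ i, F (Pi.single i 1) * z i := by
    intro z
    have := LinearMap.pi_apply_eq_sum_univ (F : (ι → ℝ) →ₗ[ℝ] ℝ) z
    simp only [ContinuousLinearMap.coe_coe, smul_eq_mul] at this
    rw [this]
    refine sum_congr rfl fun i _ => ?_
    rw [mul_comm]
    congr 2
    ext j
    simp [Pi.single_apply, eq_comm]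
  have h1 := hF1 _ ⟨f, hfK, rfl⟩
  rw [hrep] at h1 hF2
  linarith

theorem sum_range_sq_le (k : ℕ) : ∑ n ∈ range (k + 1), (n : ℝ) ^ 2 ≤ (k : ℝ) ^ 3 := by
  induction k with
  | zero => simp
  | succ k ih =>
    rw [sum_range_succ]
    push_cast
    nlinarith [(by positivity : (0 : ℝ) ≤ k)]

/-- Odd degrees vanish by the symmetry `j ↦ m - j`. For even degrees the density defect has mean
zero, so `T_n` may be replaced by `T_n - T_n(0)`, which is quadratically small near the origin; this
is the source of the gain `1/R²`. -/
theorem binMean_cliqueDensity_sub_one_mul_T_le {m n k : ℕ} (hm : 0 < m) {δ R : ℝ} (h0 : 0 ≤ δ)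
    (h1 : δ ≤ 1 / 32) (hR0 : 0 < R) (hR : 16 * (k : ℝ) ≤ R ^ 2) (hn : n ≤ k) :
    |binMean m (fun j => (cliqueDensity m δ j - 1) * (T ℝ (n : ℤ)).eval (stdz m j / R))| ≤
      3840 * δ / R ^ 2 * (n : ℝ) ^ 2 := by
  rcases Nat.even_or_odd n with he | ho
  · have hconst : binMean m (fun j => (cliqueDensity m δ j - 1)) = 0 := by
      rw [binMean_sub, binMean_const, binMean_cliqueDensity h0, sub_self]
    have hrw : binMean m (fun j => (cliqueDensity m δ j - 1) * (T ℝ (n : ℤ)).eval (stdz m j / R)) =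
        binMean m (fun j => (cliqueDensity m δ j - 1) *
          ((T ℝ (n : ℤ)).eval (stdz m j / R) - (T ℝ (n : ℤ)).eval 0)) := by
      have : ∀ j, (cliqueDensity m δ j - 1) *
          ((T ℝ (n : ℤ)).eval (stdz m j / R) - (T ℝ (n : ℤ)).eval 0) =
          (cliqueDensity m δ j - 1) * (T ℝ (n : ℤ)).eval (stdz m j / R) -
          (T ℝ (n : ℤ)).eval 0 * (cliqueDensity m δ j - 1) := fun j => by ring
      simp_rw [this]
      rw [binMean_sub, binMean_mul_left, hconst, mul_zero, sub_zero]
    rw [hrw]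
    refine (abs_binMean_le _ _).trans ?_
    have hle : ∀ j ≤ m, |(cliqueDensity m δ j - 1) *
          ((T ℝ (n : ℤ)).eval (stdz m j / R) - (T ℝ (n : ℤ)).eval 0)| ≤
        2 * (n : ℝ) ^ 2 / R ^ 2 * (|cliqueDensity m δ j - 1| *
          (stdz m j ^ 2 * Real.exp (stdz m j ^ 2 / 16))) := by
      intro j _
      rw [abs_mul, mul_left_comm]
      gcongr
      exact abs_eval_T_even_sub_le_exp he hn hR0 hR _
    refine (binMean_mono hle).trans ?_
    rw [binMean_mul_left]
    calc _ ≤ 2 * (n : ℝ) ^ 2 / R ^ 2 * (1920 * δ) := by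
          gcongr
          exact binMean_abs_cliqueDensity_mul_le hm h0 h1
      _ = _ := by ring
  · rw [binMean_odd]
    · simp only [abs_zero]; positivity
    · intro j hj
      rw [cliqueDensity_reflect δ hj, stdz_reflect hj, neg_div, T_eval_neg]
      have : (n : ℤ).negOnePow = -1 := Int.negOnePow_odd _ (by exact_mod_cast ho)
      rw [this]
      simp

/-- The clique density can be corrected, at a total variation cost of `ε`, so that its low moments
agree with those of the binomial distribution. -/
theorem exists_moment_correction {m k : ℕ} (hm : 0 < m) {δ ε R w : ℝ} (h0 : 0 ≤ δ)
    (h1 : δ ≤ 1 / 32) (hε : 0 < ε) (hR : 16 * (k : ℝ) ≤ R ^ 2) (hRm : 4 * R ≤ Real.sqrt m)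
    (hδ : 7680 * δ * (k : ℝ) ^ 3 ≤ ε * R ^ 2) (hw : 0 < w) (hwR : w ≤ R)
    (hwm : 8 ≤ w * Real.sqrt m) (hwk : 4 * (k : ℝ) ^ 3 * w ≤ R)
    (hmass : 4 * ε ≤ w / 8 * Real.exp (-R ^ 2)) :
    ∃ f : ℕ → ℝ, (∀ j, |f j| ≤ 1 / 2) ∧ binMean m (fun j => |f j|) ≤ 2 * ε ∧
      ∀ n ≤ k, binMean m (fun j => f j * (T ℝ (n : ℤ)).eval (stdz m j / R)) =
        -binMean m (fun j => (cliqueDensity m δ j - 1) * (T ℝ (n : ℤ)).eval (stdz m j / R)) := by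
  have hR0 : 0 < R := hw.trans_le hwR
  -- Admissible corrections: the box is compact by Tychonoff, and the `L¹` constraint involves
  -- finitely many coordinates, hence is closed.
  set K : Set (ℕ → ℝ) := {f | ∀ j, f j ∈ Set.Icc (-(1 / 2) : ℝ) (1 / 2)} ∩
    {f | binMean m (fun j => |f j|) ≤ 2 * ε} with hK
  have hKc : IsCompact K := by
    have hpi : {f : ℕ → ℝ | ∀ j, f j ∈ Set.Icc (-(1 / 2) : ℝ) (1 / 2)} =
        Set.univ.pi fun _ : ℕ => Set.Icc (-(1 / 2) : ℝ) (1 / 2) := by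
      ext
      exact Set.mem_univ_pi.symm
    have hcpt : IsCompact {f : ℕ → ℝ | ∀ j, f j ∈ Set.Icc (-(1 / 2) : ℝ) (1 / 2)} :=
      hpi ▸ isCompact_univ_pi fun _ => isCompact_Icc
    refine hcpt.inter_right (isClosed_le ?_ continuous_const)
    unfold binMean
    fun_prop
  have hKconv : Convex ℝ K := by
    intro f hf g hg s t hs ht hst
    refine ⟨fun j => convex_Icc _ _ (hf.1 j) (hg.1 j) hs ht hst, ?_⟩
    have hle : ∀ j ≤ m, |(s • f + t • g) j| ≤ s * |f j| + t * |g j| := by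
      intro j _
      refine (abs_add_le _ _).trans (le_of_eq ?_)
      simp [abs_mul, abs_of_nonneg hs, abs_of_nonneg ht]
    refine (binMean_mono hle).trans ?_
    rw [binMean_add, binMean_mul_left, binMean_mul_left]
    calc _ ≤ s * (2 * ε) + t * (2 * ε) :=
          add_le_add (mul_le_mul_of_nonneg_left hf.2 hs) (mul_le_mul_of_nonneg_left hg.2 ht)
      _ = (s + t) * (2 * ε) := by ring
      _ = 2 * ε := by rw [hst, one_mul]
  let Φ : (ℕ → ℝ) →ₗ[ℝ] (Fin (k + 1) → ℝ) :=
    { toFun := fun f n => binMean m (fun j => f j * (T ℝ ((n : ℕ) : ℤ)).eval (stdz m j / R))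
      map_add' := by
        intro f g
        ext n
        simp only [Pi.add_apply, add_mul, binMean_add]
      map_smul' := by
        intro c f
        ext n
        simp only [Pi.smul_apply, smul_eq_mul, mul_assoc, binMean_mul_left, RingHom.id_apply] }
  have hΦ : Continuous Φ := by
    refine continuous_pi fun n => ?_
    change Continuous fun f : ℕ → ℝ =>
      binMean m (fun j => f j * (T ℝ ((n : ℕ) : ℤ)).eval (stdz m j / R))
    unfold binMean
    fun_prop
  obtain ⟨f, hfK, hf⟩ := exists_mem_map_eq_of_forall_le hKc hKconv Φ hΦ
    (fun n => -binMean m (fun j =>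
      (cliqueDensity m δ j - 1) * (T ℝ ((n : ℕ) : ℤ)).eval (stdz m j / R))) (by
    intro a'
    obtain ⟨a, ha⟩ : ∃ a : ℕ → ℝ, ∀ n : Fin (k + 1), a' n = a n :=
      ⟨fun n => if h : n < k + 1 then a' ⟨n, h⟩ else 0, fun n => by simp [n.2]⟩
    -- A linear functional on the first `k + 1` Chebyshev moments is pairing with a polynomial `p`
    -- of degree at most `k`.
    set p : ℝ → ℝ := fun x => ∑ n ∈ range (k + 1), a n * (T ℝ (n : ℤ)).eval x with hp
    have hpc : Continuous p := by rw [hp]; fun_prop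
    obtain ⟨x₀, hx₀, hmax⟩ := (isCompact_Icc (a := (-1 : ℝ)) (b := 1)).exists_isMaxOn
      ⟨0, by norm_num⟩ (hpc.abs.continuousOn)
    set B := |p x₀| with hBdef
    have hB : ∀ x : ℝ, |x| ≤ 1 → |p x| ≤ B := fun x hx => hmax (abs_le.1 hx)
    have hcoef : ∀ n ≤ k, |a n| ≤ 2 * B := fun n hn => abs_chebyshev_coeff_le a hB hn
    have hB0 : 0 ≤ B := abs_nonneg _
    have hpair : ∀ φ : ℕ → ℝ, ∑ n : Fin (k + 1), a' n *
        binMean m (fun j => φ j * (T ℝ ((n : ℕ) : ℤ)).eval (stdz m j / R)) =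
        binMean m (fun j => φ j * p (stdz m j / R)) := by
      intro φ
      simp_rw [ha]
      rw [← Finset.sum_range (fun n => a n *
        binMean m (fun j => φ j * (T ℝ (n : ℤ)).eval (stdz m j / R)))]
      simp_rw [← binMean_mul_left]
      rw [← binMean_sum]
      simp only [hp, mul_sum, mul_left_comm]
    have hlip : ∀ x : ℝ, |x| ≤ 1 → |p x - p x₀| ≤ 2 * B * (k : ℝ) ^ 3 * |x - x₀| := by
      intro x hx
      rw [hp]
      simp only [← sum_sub_distrib, ← mul_sub]
      calc _ ≤ ∑ n ∈ range (k + 1), |a n * ((T ℝ (n : ℤ)).eval x - (T ℝ (n : ℤ)).eval x₀)| :=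
            abs_sum_le_sum_abs _ _
        _ ≤ ∑ n ∈ range (k + 1), (2 * B * |x - x₀|) * (n : ℝ) ^ 2 := by
            refine sum_le_sum fun n hn => ?_
            rw [abs_mul]
            have h3 := hcoef n (Nat.lt_succ_iff.1 (mem_range.1 hn))
            have h4 := abs_eval_T_sub_le n hx (abs_le.2 hx₀)
            calc _ ≤ 2 * B * ((n : ℝ) ^ 2 * |x - x₀|) := by gcongr
              _ = _ := by ring
        _ = (2 * B * |x - x₀|) * ∑ n ∈ range (k + 1), (n : ℝ) ^ 2 := by rw [mul_sum]
        _ ≤ (2 * B * |x - x₀|) * (k : ℝ) ^ 3 := by gcongr; exact sum_range_sq_le k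
        _ = _ := by ring
    have htarget : |binMean m (fun j => (cliqueDensity m δ j - 1) * p (stdz m j / R))| ≤ ε * B := by
      rw [← hpair]
      simp_rw [ha]
      rw [← Finset.sum_range (fun n => a n * binMean m
        (fun j => (cliqueDensity m δ j - 1) * (T ℝ (n : ℤ)).eval (stdz m j / R)))]
      refine (abs_sum_le_sum_abs _ _).trans ?_
      calc _
        _ ≤ ∑ n ∈ range (k + 1), (2 * B * (3840 * δ / R ^ 2)) * (n : ℝ) ^ 2 := by
            refine sum_le_sum fun n hn => ?_
            have hn' := Nat.lt_succ_iff.1 (mem_range.1 hn)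
            rw [abs_mul, mul_assoc (2 * B)]
            exact mul_le_mul (hcoef n hn')
              (binMean_cliqueDensity_sub_one_mul_T_le hm h0 h1 hR0 hR hn')
              (abs_nonneg _) (by positivity)
        _ = (2 * B * (3840 * δ / R ^ 2)) * ∑ n ∈ range (k + 1), (n : ℝ) ^ 2 := by rw [mul_sum]
        _ ≤ (2 * B * (3840 * δ / R ^ 2)) * (k : ℝ) ^ 3 := by gcongr; exact sum_range_sq_le k
        _ = B * ((7680 * δ * (k : ℝ) ^ 3) / R ^ 2) := by ring
        _ ≤ B * ε := by
            gcongr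
            rwa [div_le_iff₀ (by positivity)]
        _ = _ := mul_comm _ _
    -- A window at the extremal point of `p`; by `hlip` and `4k³w ≤ R`, `p` loses at most half of
    -- its extremal value there.
    obtain ⟨I, hIr, hI, hIm⟩ := exists_finset_mass_ge (y₀ := R * x₀) hm hw hwR (by
      rw [abs_mul, abs_of_pos hR0]
      exact mul_le_of_le_one_right hR0.le (abs_le.2 hx₀)) hwm hRm
    set q := (∑ j ∈ I, (m.choose j : ℝ)) / 2 ^ m with hq
    have hq4 : 4 * ε ≤ q := hmass.trans hIm
    have hq0 : 0 < q := by linarith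
    obtain ⟨σ, hσ, hσp⟩ : ∃ σ : ℝ, |σ| = 1 ∧ σ * p x₀ = B := by
      rcases le_total 0 (p x₀) with h | h
      · exact ⟨1, by norm_num, by rw [hBdef, abs_of_nonneg h, one_mul]⟩
      · exact ⟨-1, by norm_num, by rw [hBdef, abs_of_nonpos h]; ring⟩
    have hlow : ∀ j ∈ I, B / 2 ≤ σ * p (stdz m j / R) := by
      intro j hj
      obtain ⟨hj1, hj2⟩ := hI j hj
      have hx : |stdz m j / R| ≤ 1 := by
        rw [abs_div, abs_of_pos hR0, div_le_one hR0]; exact hj2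
      have h3 := hlip _ hx
      have h4 : |stdz m j / R - x₀| ≤ w / R := by
        rw [show stdz m j / R - x₀ = (stdz m j - R * x₀) / R by field_simp, abs_div,
          abs_of_pos hR0]
        gcongr
      have h5 : 2 * B * (k : ℝ) ^ 3 * |stdz m j / R - x₀| ≤ B / 2 := by
        calc _ ≤ 2 * B * (k : ℝ) ^ 3 * (w / R) := by gcongr
          _ = B / 2 * ((4 * (k : ℝ) ^ 3 * w) / R) := by ring
          _ ≤ B / 2 * 1 := by
            gcongr
            rwa [div_le_one hR0]
          _ = _ := mul_one _
      have h6 : |σ * (p (stdz m j / R) - p x₀)| ≤ B / 2 := by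
        rw [abs_mul, hσ, one_mul]; exact h3.trans h5
      have := (abs_le.1 h6).1
      rw [mul_sub, hσp] at this
      linarith
    have hsum : ∀ ψ : ℕ → ℝ, binMean m (fun j => if j ∈ I then ψ j else 0) =
        (∑ j ∈ I, (m.choose j : ℝ) * ψ j) / 2 ^ m := by
      intro ψ
      unfold binMean
      simp only [mul_ite, mul_zero]
      rw [← sum_filter, filter_mem_eq_inter, inter_eq_right.2 hIr]
    -- A signed bump of `L¹` mass exactly `2ε`. Its height is at most `1/2` because `q ≥ 4ε`, and it
    -- pairs with `p` to at least `2ε · B/2 = εB`.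
    refine ⟨fun j => if j ∈ I then σ * (2 * ε / q) else 0, ⟨fun j => ?_, ?_⟩, ?_⟩
    · have hc : |σ * (2 * ε / q)| ≤ 1 / 2 := by
        rw [abs_mul, hσ, one_mul, abs_of_nonneg (by positivity), div_le_div_iff₀ hq0 (by norm_num)]
        linarith
      change (if j ∈ I then σ * (2 * ε / q) else 0) ∈ _
      split_ifs
      · exact abs_le.1 hc
      · norm_num
    · have hrw : (fun j => |if j ∈ I then σ * (2 * ε / q) else 0|) =
          fun j => if j ∈ I then 2 * ε / q else 0 := by
        ext j
        split_ifs
        · rw [abs_mul, hσ, one_mul, abs_of_nonneg (by positivity)]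
        · exact abs_zero
      change binMean m (fun j => |if j ∈ I then σ * (2 * ε / q) else 0|) ≤ 2 * ε
      rw [hrw, hsum, ← sum_mul, mul_div_right_comm, ← hq]
      exact le_of_eq (by field_simp)
    · simp only [mul_neg, sum_neg_distrib]
      rw [hpair]
      change _ ≤ ∑ n : Fin (k + 1), a' n * binMean m (fun j => _ * _)
      rw [hpair]
      refine (neg_le_abs _).trans (htarget.trans ?_)
      simp only [ite_mul, zero_mul]
      rw [hsum, le_div_iff₀ (by positivity)]
      calc ε * B * 2 ^ m = ∑ j ∈ I, (m.choose j : ℝ) * ((2 * ε / q) * (B / 2)) := by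
            rw [← sum_mul]
            have : (∑ j ∈ I, (m.choose j : ℝ)) = q * 2 ^ m := by rw [hq]; field_simp
            rw [this]
            field_simp
        _ ≤ _ := by
            refine sum_le_sum fun j hj => ?_
            have := hlow j hj
            rw [show σ * (2 * ε / q) * p (stdz m j / R) =
              (2 * ε / q) * (σ * p (stdz m j / R)) by ring]
            gcongr)
  refine ⟨f, fun j => abs_le.2 (hfK.1 j), hfK.2, fun n hn => ?_⟩
  exact congrFun hf ⟨n, Nat.lt_succ_of_le hn⟩

/-- Vanishing against the first Chebyshev polynomials is vanishing against low powers. -/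
theorem binMean_mul_pow_eq_zero {m k : ℕ} {R : ℝ} (hR : 0 < R) (u : ℕ → ℝ)
    (h : ∀ n ≤ k, binMean m (fun j => u j * (T ℝ (n : ℤ)).eval (stdz m j / R)) = 0) :
    ∀ n ≤ k, binMean m (fun j => u j * ((m : ℝ) - 2 * j) ^ n) = 0 := by
  have hpoly : ∀ n ≤ k, ∀ P : ℝ[X], P.natDegree ≤ n →
      binMean m (fun j => u j * P.eval (stdz m j / R)) = 0 := by
    intro n
    induction n with
    | zero =>
      intro _ P hP
      rw [eq_C_of_natDegree_le_zero hP]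
      have := h 0 (Nat.zero_le _)
      simp only [Nat.cast_zero, T_zero, eval_one, mul_one] at this
      simp only [eval_C, mul_comm _ (P.coeff 0)]
      rw [binMean_mul_left, this, mul_zero]
    | succ n ih =>
      intro hnk P hP
      set c := P.coeff (n + 1) / (T ℝ ((n + 1 : ℕ) : ℤ)).leadingCoeff with hc
      have hdeg : (T ℝ ((n + 1 : ℕ) : ℤ)).natDegree = n + 1 := by
        rw [natDegree_T]; rfl
      have hlc : (T ℝ ((n + 1 : ℕ) : ℤ)).leadingCoeff ≠ 0 :=
        leadingCoeff_ne_zero.2 (T_ne_zero ℝ _)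
      -- Since `T_{n+1}` has degree exactly `n + 1`, a multiple of it cancels the top coefficient of
      -- `P`.
      have hQ : (P - C c * T ℝ ((n + 1 : ℕ) : ℤ)).natDegree ≤ n := by
        rw [natDegree_le_iff_coeff_eq_zero]
        intro N hN
        rcases eq_or_lt_of_le (Nat.succ_le_of_lt hN) with h | h
        · rw [← h, coeff_sub, coeff_C_mul]
          have : (T ℝ ((n + 1 : ℕ) : ℤ)).coeff (n + 1) =
              (T ℝ ((n + 1 : ℕ) : ℤ)).leadingCoeff := by rw [leadingCoeff, hdeg]
          rw [Nat.succ_eq_add_one, this, hc]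
          field_simp
          ring
        · rw [coeff_sub, coeff_C_mul, coeff_eq_zero_of_natDegree_lt (by omega),
            coeff_eq_zero_of_natDegree_lt (by omega)]
          ring
      have h1 := ih (by omega) _ hQ
      simp only [eval_sub, eval_mul, eval_C, mul_sub, mul_left_comm _ c] at h1
      rw [binMean_sub, binMean_mul_left, h (n + 1) hnk, mul_zero, sub_zero] at h1
      exact h1
  intro n hn
  rcases Nat.eq_zero_or_pos m with rfl | hm
  · rcases Nat.eq_zero_or_pos n with rfl | hn0
    · simpa using hpoly 0 hn 1 (by simp)
    · unfold binMean
      simp [hn0.ne']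
  have hs : 0 < Real.sqrt m := Real.sqrt_pos.2 (by exact_mod_cast hm)
  have := hpoly n hn (C ((R * Real.sqrt m) ^ n) * X ^ n) (natDegree_C_mul_X_pow_le _ _)
  rw [← this]
  refine binMean_congr fun j _ => ?_
  rw [eval_mul, eval_C, eval_pow, eval_X, ← mul_pow, stdz]
  congr 2
  field_simp

/-- The moment-matching density near the clique density. -/
theorem exists_moment_matching_density {m k : ℕ} (hm : 0 < m) {δ ε R w : ℝ} (h0 : 0 ≤ δ)
    (h1 : δ ≤ 1 / 48) (hε : 0 < ε) (hR : 16 * (k : ℝ) ≤ R ^ 2) (hRm : 4 * R ≤ Real.sqrt m)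
    (hδ : 7680 * δ * (k : ℝ) ^ 3 ≤ ε * R ^ 2) (hw : 0 < w) (hwR : w ≤ R)
    (hwm : 8 ≤ w * Real.sqrt m) (hwk : 4 * (k : ℝ) ^ 3 * w ≤ R)
    (hmass : 4 * ε ≤ w / 8 * Real.exp (-R ^ 2)) :
    ∃ g : ℕ → ℝ, (∀ j, 0 ≤ g j) ∧ binMean m (fun j => |g j - cliqueDensity m δ j|) ≤ 2 * ε ∧
      binMean m (fun j => (g j - 1) ^ 2) ≤ 600 * δ + 2 * ε ∧
      ∀ n ≤ k, binMean m (fun j => (g j - 1) * ((m : ℝ) - 2 * j) ^ n) = 0 := by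
  obtain ⟨f, hf1, hf2, hf3⟩ := exists_moment_correction hm h0 (h1.trans (by norm_num)) hε hR hRm hδ
    hw hwR hwm hwk hmass
  refine ⟨fun j => cliqueDensity m δ j + f j, fun j => ?_, ?_, ?_, ?_⟩
  · have := half_le_cliqueDensity hm h0 h1 j
    have := (abs_le.1 (hf1 j)).1
    linarith
  · simpa using hf2
  -- From `(a+b)² ≤ 2a² + 2b²` and `f² ≤ |f|/2`: the correction enters the variance only through its
  -- `L¹` norm.
  · have hle : ∀ j ≤ m, (cliqueDensity m δ j + f j - 1) ^ 2 ≤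
        2 * (cliqueDensity m δ j - 1) ^ 2 + 1 * |f j| := by
      intro j _
      have h3 : f j ^ 2 ≤ 1 / 2 * |f j| := by
        rw [← sq_abs, sq]
        gcongr
        exact hf1 j
      nlinarith [sq_nonneg (cliqueDensity m δ j - 1 - f j)]
    refine (binMean_mono hle).trans ?_
    rw [binMean_add, binMean_mul_left, binMean_mul_left]
    have := binMean_cliqueDensity_sub_one_sq_le hm h0 (h1.trans (by norm_num))
    linarith
  · refine binMean_mul_pow_eq_zero (hw.trans_le hwR) _ fun n hn => ?_
    have : ∀ j, (cliqueDensity m δ j + f j - 1) * (T ℝ (n : ℤ)).eval (stdz m j / R) =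
        (cliqueDensity m δ j - 1) * (T ℝ (n : ℤ)).eval (stdz m j / R) +
        f j * (T ℝ (n : ℤ)).eval (stdz m j / R) := fun j => by ring
    simp_rw [this]
    rw [binMean_add, hf3 n hn]
    ring

end IsingSQ

/-! ### Walsh–Fourier analysis of functions of a weight. -/

namespace IsingSQ

open Finset

/-- The number of ones of `x` in `S`. -/
def weight {M : ℕ} (S : Finset (Fin M)) (x : Hypercube M) : ℕ := ∑ i ∈ S, (x i : ℕ)

/-- The mean of a function under the uniform distribution on the cube. -/
noncomputable def cubeMean {M : ℕ} (F : Hypercube M → ℝ) : ℝ := (∑ x, F x) / 2 ^ M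

/-- The sign `(-1)^{x_i}`. -/
def sgn {M : ℕ} (x : Hypercube M) (i : Fin M) : ℝ := (-1) ^ (x i : ℕ)

/-- The Walsh character of `V`. -/
def walsh {M : ℕ} (V : Finset (Fin M)) (x : Hypercube M) : ℝ := ∏ i ∈ V, sgn x i

/-- The Walsh-Fourier coefficient of `F` at `V`. -/
noncomputable def fourierCoef {M : ℕ} (F : Hypercube M → ℝ) (V : Finset (Fin M)) : ℝ :=
  cubeMean fun x => F x * walsh V x

theorem cubeMean_sum {M : ℕ} {ι : Type*} (s : Finset ι) (F : ι → Hypercube M → ℝ) :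
    cubeMean (fun x => ∑ i ∈ s, F i x) = ∑ i ∈ s, cubeMean (F i) := by
  unfold cubeMean
  rw [sum_comm, sum_div]

theorem cubeMean_add {M : ℕ} (F G : Hypercube M → ℝ) :
    cubeMean (fun x => F x + G x) = cubeMean F + cubeMean G := by
  unfold cubeMean
  rw [sum_add_distrib, add_div]

theorem cubeMean_mul_left {M : ℕ} (c : ℝ) (F : Hypercube M → ℝ) :
    cubeMean (fun x => c * F x) = c * cubeMean F := by
  unfold cubeMean
  rw [← mul_sum, mul_div_assoc]

theorem cubeMean_comp_equiv {M : ℕ} (e : Hypercube M ≃ Hypercube M) (F : Hypercube M → ℝ) :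
    cubeMean (fun x => F (e x)) = cubeMean F := by
  unfold cubeMean
  rw [Equiv.sum_comp e F]

theorem sgn_mul_self {M : ℕ} (x : Hypercube M) (i : Fin M) : sgn x i * sgn x i = 1 := by
  unfold sgn
  rw [← mul_pow]
  norm_num

theorem sgn_eq {M : ℕ} (x : Hypercube M) (i : Fin M) : sgn x i = 1 - 2 * ((x i : ℕ) : ℝ) := by
  unfold sgn
  generalize x i = a
  fin_cases a <;> norm_num

theorem sum_sgn {M : ℕ} (S : Finset (Fin M)) (x : Hypercube M) :
    ∑ i ∈ S, sgn x i = (S.card : ℝ) - 2 * weight S x := by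
  simp only [sgn_eq, sum_sub_distrib, weight, Nat.cast_sum, mul_sum]
  simp

/-- Each point of `D` may be in or out without affecting the summand, hence doubles the sum. -/
theorem sum_powerset_card_inter {α : Type*} [DecidableEq α] (S D : Finset α)
    (hSD : Disjoint S D) (φ : ℕ → ℝ) :
    ∑ X ∈ (S ∪ D).powerset, φ (X ∩ S).card =
      2 ^ D.card * ∑ X ∈ S.powerset, φ X.card := by
  induction D using Finset.induction_on with
  | empty =>
    rw [union_empty, card_empty, pow_zero, one_mul]
    exact sum_congr rfl fun X hX => by rw [inter_eq_left.2 (mem_powerset.1 hX)]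
  | insert a D ha ih =>
    rw [disjoint_insert_right] at hSD
    have hn : a ∉ S ∪ D := by simp [hSD.1, ha]
    rw [union_insert, sum_powerset_insert hn]
    have : ∀ X ∈ (S ∪ D).powerset, φ (insert a X ∩ S).card = φ (X ∩ S).card := by
      intro X _
      rw [insert_inter_of_notMem hSD.1]
    rw [sum_congr rfl this, ih hSD.2, card_insert_of_notMem ha]
    ring

theorem cubeMean_weight {M : ℕ} (S : Finset (Fin M)) (φ : ℕ → ℝ) :
    cubeMean (fun x => φ (weight S x)) = binMean S.card φ := by
  let e : Hypercube M ≃ Finset (Fin M) :=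
    { toFun := fun x => univ.filter fun i => x i = 1
      invFun := fun X i => if i ∈ X then 1 else 0
      left_inv := by
        intro x
        ext i
        by_cases h : x i = 1
        · simp [h]
        · have : x i = 0 := by omega
          simp [this]
      right_inv := by
        intro X
        ext i
        simp }
  have hw : ∀ x, weight S x = (e x ∩ S).card := by
    intro x
    have : e x ∩ S = S.filter fun i => x i = 1 := by
      ext i; simp [e, and_comm]
    rw [this, card_filter]
    unfold weight
    refine sum_congr rfl fun i _ => ?_
    generalize x i = a
    fin_cases a <;> simp
  have h1 : ∑ x, φ (weight S x) = ∑ X : Finset (Fin M), φ (X ∩ S).card := by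
    simp_rw [hw]
    exact Equiv.sum_comp e fun X => φ (X ∩ S).card
  have h2 := sum_powerset_card_inter S (univ \ S) disjoint_sdiff φ
  rw [union_sdiff_of_subset (subset_univ S), powerset_univ] at h2
  unfold cubeMean binMean
  rw [h1, h2, sum_powerset_apply_card]
  have hc : (univ \ S).card + S.card = M := by
    rw [card_sdiff_add_card_eq_card (subset_univ S)]; simp
  have : (2 : ℝ) ^ M = 2 ^ (univ \ S).card * 2 ^ S.card := by rw [← pow_add, hc]
  rw [this, mul_div_mul_left _ _ (by positivity)]
  simp only [nsmul_eq_mul]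

theorem sum_walsh_mul_walsh {M : ℕ} (x y : Hypercube M) :
    ∑ V, walsh V x * walsh V y = if x = y then 2 ^ M else 0 := by
  have h : ∑ V : Finset (Fin M), walsh V x * walsh V y = ∏ i, (1 + sgn x i * sgn y i) := by
    rw [prod_one_add, powerset_univ]
    simp only [walsh, prod_mul_distrib]
  rw [h]
  split_ifs with hxy
  · subst hxy
    simp only [sgn_mul_self]
    norm_num
  · obtain ⟨i, hi⟩ := Function.ne_iff.1 hxy
    refine prod_eq_zero (mem_univ i) ?_
    unfold sgn
    revert hi
    generalize x i = a
    generalize y i = b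
    intro hi
    fin_cases a <;> fin_cases b <;> simp_all

/-- Parseval's identity on the cube. -/
theorem cubeMean_mul_eq_sum {M : ℕ} (F G : Hypercube M → ℝ) :
    cubeMean (fun x => F x * G x) = ∑ V, fourierCoef F V * fourierCoef G V := by
  have h : ∑ V : Finset (Fin M), (∑ x, F x * walsh V x) * (∑ y, G y * walsh V y) =
      2 ^ M * ∑ x, F x * G x := by
    simp_rw [sum_mul_sum]
    rw [sum_comm]
    simp_rw [sum_comm (s := (univ : Finset (Finset (Fin M))))]
    have : ∀ x y, ∑ V, F x * walsh V x * (G y * walsh V y) =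
        F x * G y * if x = y then 2 ^ M else 0 := by
      intro x y
      rw [← sum_walsh_mul_walsh, mul_sum]
      exact sum_congr rfl fun V _ => by ring
    simp_rw [this]
    simp only [mul_ite, mul_zero, sum_ite_eq, mem_univ, if_true]
    rw [mul_sum]
    exact sum_congr rfl fun x _ => by ring
  unfold fourierCoef cubeMean
  simp_rw [div_mul_div_comm]
  rw [← sum_div, h]
  field_simp

/-- Flipping a coordinate in `V \ S` preserves the weight on `S` and negates the character. -/
theorem fourierCoef_weight_eq_zero {M : ℕ} (u : ℕ → ℝ) {S V : Finset (Fin M)} (h : ¬ V ⊆ S) :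
    fourierCoef (fun x => u (weight S x)) V = 0 := by
  obtain ⟨i, hiV, hiS⟩ := not_subset.1 h
  let flip : Hypercube M ≃ Hypercube M :=
    { toFun := fun x => Function.update x i (1 - x i)
      invFun := fun x => Function.update x i (1 - x i)
      left_inv := fun x => by ext j; by_cases hj : j = i <;> simp [hj]
      right_inv := fun x => by ext j; by_cases hj : j = i <;> simp [hj] }
  have hw : ∀ x, weight S (flip x) = weight S x := fun x =>
    sum_congr rfl fun j hj => by
      have : j ≠ i := fun h => hiS (h ▸ hj)
      simp [flip, this]
  have hc : ∀ x, walsh V (flip x) = -walsh V x := by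
    intro x
    unfold walsh
    rw [← mul_prod_erase V _ hiV, ← mul_prod_erase V (fun j => sgn x j) hiV]
    have h1 : sgn (flip x) i = -sgn x i := by
      simp only [sgn, flip, Equiv.coe_fn_mk, Function.update_self]
      generalize x i = a
      fin_cases a <;> simp
    have h2 : ∏ j ∈ V.erase i, sgn (flip x) j = ∏ j ∈ V.erase i, sgn x j :=
      prod_congr rfl fun j hj => by simp [sgn, flip, ne_of_mem_erase hj]
    rw [h1, h2, neg_mul]
  have := cubeMean_comp_equiv flip fun x => u (weight S x) * walsh V x
  simp only [hw, hc] at this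
  have h3 : cubeMean (fun x => u (weight S x) * -walsh V x) =
      -1 * cubeMean (fun x => u (weight S x) * walsh V x) := by
    rw [← cubeMean_mul_left]
    congr 1
    ext x
    ring
  rw [h3] at this
  unfold fourierCoef
  linarith

/-- Colour each point by its membership in the two nested sets; the colour classes on both sides
have equal sizes, so bijections between them glue to a permutation. -/
theorem exists_perm_map_eq {α : Type*} [Fintype α] [DecidableEq α] {S T V W : Finset α}
    (hV : V ⊆ S) (hW : W ⊆ T) (hST : S.card = T.card) (hVW : V.card = W.card) :
    ∃ e : Equiv.Perm α, T.map e.toEmbedding = S ∧ W.map e.toEmbedding = V := by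
  have hcard : ∀ (S V : Finset α), V ⊆ S → ∀ c : Bool × Bool,
      Fintype.card {a // (decide (a ∈ S), decide (a ∈ V)) = c} =
      match c with
      | (true, true) => V.card
      | (true, false) => S.card - V.card
      | (false, true) => 0
      | (false, false) => Fintype.card α - S.card := by
    intro S V hV c
    rw [Fintype.card_subtype]
    rcases c with ⟨_ | _, _ | _⟩ <;> simp only [Prod.mk.injEq, decide_eq_true_eq, decide_eq_false_iff_not]
    · rw [← card_compl]
      congr 1
      ext a
      simp only [mem_filter, mem_univ, true_and, mem_compl]
      exact ⟨fun h => h.1, fun h => ⟨h, fun h' => h (hV h')⟩⟩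
    · rw [card_eq_zero]
      ext a
      simp only [mem_filter, mem_univ, true_and, notMem_empty, iff_false]
      exact fun h => h.1 (hV h.2)
    · rw [← card_sdiff_of_subset hV]
      congr 1
      ext a
      simp
    · congr 1
      ext a
      simp only [mem_filter, mem_univ, true_and]
      exact ⟨fun h => h.2, fun h => ⟨hV h, h⟩⟩
  have e : ∀ c : Bool × Bool, Nonempty ({a // (decide (a ∈ T), decide (a ∈ W)) = c} ≃
      {a // (decide (a ∈ S), decide (a ∈ V)) = c}) := by
    intro c
    refine Fintype.card_eq.1 ?_
    rw [hcard S V hV, hcard T W hW, hST, hVW]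
  let e' := fun c => (e c).some
  have hmap := Equiv.ofFiberEquiv_map e'
  refine ⟨Equiv.ofFiberEquiv e', ?_, ?_⟩
  · refine eq_of_subset_of_card_le (fun a ha => ?_) (by rw [card_map, hST])
    obtain ⟨b, hb, rfl⟩ := mem_map.1 ha
    have := congrArg Prod.fst (hmap b)
    simpa [hb] using this
  · refine eq_of_subset_of_card_le (fun a ha => ?_) (by rw [card_map, hVW])
    obtain ⟨b, hb, rfl⟩ := mem_map.1 ha
    have := congrArg Prod.snd (hmap b)
    simpa [hb] using this

theorem fourierCoef_weight_congr {M : ℕ} (u : ℕ → ℝ) {S T V W : Finset (Fin M)}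
    (hV : V ⊆ S) (hW : W ⊆ T) (hST : S.card = T.card) (hVW : V.card = W.card) :
    fourierCoef (fun x => u (weight S x)) V = fourierCoef (fun x => u (weight T x)) W := by
  obtain ⟨e, rfl, rfl⟩ := exists_perm_map_eq hV hW hST hVW
  have := cubeMean_comp_equiv (Equiv.arrowCongr e.symm (Equiv.refl (Fin 2)))
    fun x : Hypercube M => u (weight T x) * walsh W x
  unfold fourierCoef
  rw [← this]
  unfold weight walsh sgn
  simp [sum_map, prod_map, Equiv.arrowCongr]

/-- A function of the weight on `S` whose first moments vanish has no low-degree part. -/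
theorem fourierCoef_weight_eq_zero_of_moments {M : ℕ} (S : Finset (Fin M)) (j : ℕ) :
    ∀ u : ℕ → ℝ,
      (∀ n ≤ j, binMean S.card (fun i => u i * ((S.card : ℝ) - 2 * i) ^ n) = 0) →
      ∀ V ⊆ S, V.card = j → fourierCoef (fun x => u (weight S x)) V = 0 := by
  induction j using Nat.strong_induction_on with
  | _ j ih =>
    intro u hu V hVS hVj
    rcases Nat.eq_zero_or_pos j with rfl | hj
    · rw [card_eq_zero] at hVj
      subst hVj
      have := hu 0 le_rfl
      simp only [pow_zero, mul_one] at this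
      unfold fourierCoef walsh
      simpa [cubeMean_weight] using this
    obtain ⟨i₀, hi₀⟩ : V.Nonempty := card_pos.1 (by omega)
    set W := V.erase i₀ with hW
    have hWc : W.card = j - 1 := by rw [hW, card_erase_of_mem hi₀, hVj]
    have hWS : W ⊆ S := (erase_subset _ _).trans hVS
    -- Multiplication by `|S| - 2·weight = ∑_{i∈S} sgn x i` shifts the moments by one and moves the
    -- character of `W` to its neighbours of sizes `j` and `j - 2`. The smaller ones vanish by
    -- induction; the larger ones share one coefficient by symmetry, and it must then be zero.
    have h1 := ih (j - 1) (by omega) (fun i => u i * ((S.card : ℝ) - 2 * i)) (by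
      intro n hn
      have := hu (n + 1) (by omega)
      simpa only [pow_succ', mul_assoc] using this) W hWS hWc
    have hexp : ∀ x : Hypercube M, (u (weight S x) * ((S.card : ℝ) - 2 * weight S x)) * walsh W x =
        (∑ i ∈ S \ W, u (weight S x) * walsh (insert i W) x) +
        ∑ i ∈ W, u (weight S x) * walsh (W.erase i) x := by
      intro x
      rw [← sum_sgn, ← sum_sdiff hWS, ← mul_sum, ← mul_sum, ← mul_add, mul_assoc, add_mul]
      congr 2
      · rw [sum_mul]
        refine sum_congr rfl fun i hi => ?_
        rw [walsh, walsh, prod_insert (mem_sdiff.1 hi).2]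
      · rw [sum_mul]
        refine sum_congr rfl fun i hi => ?_
        rw [walsh, walsh, ← mul_prod_erase W _ hi, ← mul_assoc, sgn_mul_self, one_mul]
    unfold fourierCoef at h1
    simp_rw [hexp] at h1
    rw [cubeMean_add, cubeMean_sum, cubeMean_sum] at h1
    have h2 : ∀ i ∈ W, cubeMean (fun x => u (weight S x) * walsh (W.erase i) x) = 0 := by
      intro i hi
      have hpos : 0 < W.card := card_pos.2 ⟨i, hi⟩
      exact ih (j - 2) (by omega) u (fun n hn => hu n (by omega)) _
        ((erase_subset _ _).trans hWS) (by rw [card_erase_of_mem hi]; omega)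
    have h3 : ∀ i ∈ S \ W, cubeMean (fun x => u (weight S x) * walsh (insert i W) x) =
        fourierCoef (fun x => u (weight S x)) V := by
      intro i hi
      refine fourierCoef_weight_congr u (insert_subset (mem_sdiff.1 hi).1 hWS) hVS rfl ?_
      rw [card_insert_of_notMem (mem_sdiff.1 hi).2]
      omega
    rw [sum_congr rfl h2, sum_congr rfl h3, sum_const_zero, add_zero, sum_const, nsmul_eq_mul,
      mul_eq_zero] at h1
    refine h1.resolve_left (Nat.cast_ne_zero.2 (card_pos.2 ⟨i₀, ?_⟩).ne')
    exact mem_sdiff.2 ⟨hVS hi₀, notMem_erase _ _⟩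

theorem descFactorial_mul_pow_le {r m : ℕ} (h : r ≤ m) (j : ℕ) :
    r.descFactorial j * m ^ j ≤ m.descFactorial j * r ^ j := by
  induction j with
  | zero => simp
  | succ j ih =>
    rw [Nat.descFactorial_succ, Nat.descFactorial_succ, pow_succ, pow_succ]
    have h1 : (r - j) * m ≤ (m - j) * r := by
      rw [Nat.sub_mul, Nat.sub_mul, mul_comm r m]
      exact Nat.sub_le_sub_left (Nat.mul_le_mul_left j h) _
    calc (r - j) * r.descFactorial j * (m ^ j * m)
        = ((r - j) * m) * (r.descFactorial j * m ^ j) := by ring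
      _ ≤ ((m - j) * r) * (m.descFactorial j * r ^ j) := Nat.mul_le_mul h1 ih
      _ = _ := by ring

theorem choose_mul_pow_le {r m : ℕ} (h : r ≤ m) (j : ℕ) :
    r.choose j * m ^ j ≤ m.choose j * r ^ j := by
  have := descFactorial_mul_pow_le h j
  rw [Nat.descFactorial_eq_factorial_mul_choose, Nat.descFactorial_eq_factorial_mul_choose,
    mul_assoc, mul_assoc] at this
  exact Nat.le_of_mul_le_mul_left this (Nat.factorial_pos j)

theorem choose_le_div_pow_mul {r m : ℕ} (hm : 0 < m) (h : r ≤ m) (j : ℕ) :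
    (r.choose j : ℝ) ≤ ((r : ℝ) / m) ^ j * m.choose j := by
  have := choose_mul_pow_le h j
  have h2 : (r.choose j : ℝ) * (m : ℝ) ^ j ≤ (m.choose j : ℝ) * (r : ℝ) ^ j := by exact_mod_cast this
  rw [div_pow, div_mul_eq_mul_div, le_div_iff₀ (by positivity), mul_comm ((r : ℝ) ^ j)]
  exact h2

/-- Functions of the weights on two cliques with small intersection are nearly uncorrelated. -/
theorem abs_cubeMean_mul_weight_le {M m k : ℕ} (hm : 0 < m) {S T : Finset (Fin M)}
    (hS : S.card = m) (hT : T.card = m) (u : ℕ → ℝ)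
    (hu : ∀ n ≤ k, binMean m (fun i => u i * ((m : ℝ) - 2 * i) ^ n) = 0) :
    |cubeMean (fun x => u (weight S x) * u (weight T x))| ≤
      (((S ∩ T).card : ℝ) / m) ^ (k + 1) * binMean m (fun i => u i ^ 2) := by
  -- The common coefficient on subsets of `S` of size `j`; the default `0` applies when `j` exceeds
  -- `|S|`.
  set c : ℕ → ℝ := fun j => if h : ∃ V ⊆ S, V.card = j then
    fourierCoef (fun x => u (weight S x)) h.choose else 0 with hc
  have hcS : ∀ V ⊆ S, fourierCoef (fun x => u (weight S x)) V = c V.card := by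
    intro V hV
    have h : ∃ W ⊆ S, W.card = V.card := ⟨V, hV, rfl⟩
    rw [hc]
    simp only [h, dif_pos]
    exact fourierCoef_weight_congr u hV h.choose_spec.1 rfl h.choose_spec.2.symm
  have hc0 : ∀ j ≤ k, c j = 0 := by
    intro j hj
    rw [hc]
    dsimp only
    split_ifs with h
    · exact fourierCoef_weight_eq_zero_of_moments S j u (fun n hn => by
        rw [hS]; exact hu n (hn.trans hj)) _ h.choose_spec.1 h.choose_spec.2
    · rfl
  have hzero : ∀ A ⊆ S, ∀ F : Finset (Fin M) → ℝ, (∀ V, ¬ V ⊆ A → F V = 0) →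
      (∀ V ⊆ A, F V = c V.card ^ 2) →
      ∑ V, F V = ∑ j ∈ range (A.card + 1), (A.card.choose j : ℝ) * c j ^ 2 := by
    intro A _ F h0 h1
    have h3 := sum_powerset_apply_card (fun j => c j ^ 2) (x := A)
    simp only [nsmul_eq_mul] at h3
    rw [← h3]
    symm
    refine (sum_congr rfl fun V hV => (h1 V (mem_powerset.1 hV)).symm).trans ?_
    exact sum_subset (subset_univ _) fun V _ hV => h0 V (by simpa using hV)
  have hnorm : binMean m (fun i => u i ^ 2) =
      ∑ j ∈ range (m + 1), (m.choose j : ℝ) * c j ^ 2 := by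
    rw [← hS, ← cubeMean_weight S fun i => u i ^ 2]
    simp_rw [sq]
    rw [cubeMean_mul_eq_sum]
    simp_rw [← sq]
    refine hzero S subset_rfl (fun V => fourierCoef (fun x => u (weight S x)) V ^ 2)
      (fun V hV => ?_) fun V hV => ?_
    · rw [fourierCoef_weight_eq_zero u hV]; ring
    · rw [hcS V hV]
  set r := (S ∩ T).card with hr
  have hrm : r ≤ m := hS ▸ card_le_card inter_subset_left
  -- Only `V ⊆ S ∩ T` contribute. The squared norm is the same sum with `m` for `r`, so the terms `j
  -- > k` are compared through `C(r,j) ≤ (r/m)^j · C(m,j)`.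
  have hcor : cubeMean (fun x => u (weight S x) * u (weight T x)) =
      ∑ j ∈ range (r + 1), (r.choose j : ℝ) * c j ^ 2 := by
    rw [cubeMean_mul_eq_sum]
    refine hzero (S ∩ T) inter_subset_left _ (fun V hV => ?_) fun V hV => ?_
    · rw [subset_inter_iff, not_and_or] at hV
      rcases hV with hV | hV
      · rw [fourierCoef_weight_eq_zero u hV, zero_mul]
      · rw [fourierCoef_weight_eq_zero u hV, mul_zero]
    · rw [subset_inter_iff] at hV
      rw [← fourierCoef_weight_congr u hV.1 hV.2 (hS.trans hT.symm) rfl, hcS V hV.1, sq]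
  rw [hcor, hnorm, abs_of_nonneg (sum_nonneg fun j _ => by positivity), mul_sum]
  refine (sum_le_sum_of_subset_of_nonneg (range_mono (by omega : r + 1 ≤ m + 1))
    fun j _ _ => by positivity).trans (sum_le_sum fun j _ => ?_)
  rcases le_or_gt j k with hjk | hjk
  · simp [hc0 j hjk]
  · rw [← mul_assoc]
    gcongr
    refine (choose_le_div_pow_mul hm hrm j).trans ?_
    gcongr ?_ * _
    refine pow_le_pow_of_le_one (by positivity) ?_ hjk
    rw [div_le_one (by exact_mod_cast hm)]
    exact_mod_cast hrm

end IsingSQ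

/-! ### Random intersections, and query bounds from pairwise correlations. -/

namespace IsingSQ

open Finset MeasureTheory

/-- Exponential moment of the intersection of two random subsets of the same size. -/
theorem sum_two_pow_card_inter_le {M m : ℕ} (hmM : m ≤ M) (hM : 0 < M) {S : Finset (Fin M)}
    (hS : S.card = m) :
    ∑ T ∈ powersetCard m (univ : Finset (Fin M)), (2 : ℝ) ^ (S ∩ T).card ≤
      (M.choose m : ℝ) * Real.exp ((m : ℝ) ^ 2 / M) := by
  -- `2^|S∩T|` counts the `V ⊆ S` contained in `T`, and a random `T` contains `V` with probability
  -- at most `(m/M)^|V|`. Summing over `V` gives `(1 + m/M)^m`.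
  have h1 : ∀ T : Finset (Fin M), (2 : ℝ) ^ (S ∩ T).card =
      ∑ V ∈ S.powerset, if V ⊆ T then 1 else 0 := by
    intro T
    rw [← sum_filter]
    have : S.powerset.filter (fun V => V ⊆ T) = (S ∩ T).powerset := by
      ext V; rw [mem_filter, mem_powerset, mem_powerset, subset_inter_iff]
    rw [this, sum_const, card_powerset]
    simp
  simp_rw [h1]
  rw [sum_comm]
  have h2 : ∀ V ∈ S.powerset, ∑ T ∈ powersetCard m (univ : Finset (Fin M)),
      (if V ⊆ T then (1 : ℝ) else 0) ≤ (M.choose m : ℝ) * ((m : ℝ) / M) ^ V.card := by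
    intro V hV
    have hVm : V.card ≤ m := hS ▸ card_le_card (mem_powerset.1 hV)
    rw [← sum_filter, sum_const, nsmul_eq_mul, mul_one]
    rw [card_filter_powersetCard_subset V univ m (subset_univ V) hVm, card_univ, Fintype.card_fin]
    have h4 : (M.choose m : ℝ) * (m.choose V.card : ℝ) =
        (M.choose V.card : ℝ) * ((M - V.card).choose (m - V.card) : ℝ) := by
      exact_mod_cast Nat.choose_mul hVm
    have h5 := choose_le_div_pow_mul hM hmM V.card
    have h6 : (0 : ℝ) < M.choose V.card := by
      exact_mod_cast Nat.choose_pos (hVm.trans hmM)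
    refine le_of_mul_le_mul_left ?_ h6
    rw [← h4]
    calc _ ≤ (M.choose m : ℝ) * (((m : ℝ) / M) ^ V.card * M.choose V.card) := by gcongr
      _ = _ := by ring
  refine (sum_le_sum h2).trans ?_
  rw [← mul_sum]
  gcongr
  have h7 : ∑ V ∈ S.powerset, ((m : ℝ) / M) ^ V.card = (1 + (m : ℝ) / M) ^ m := by
    have := prod_one_add (f := fun _ : Fin M => (m : ℝ) / M) S
    simp only [prod_const, hS] at this
    exact this.symm
  rw [h7]
  calc (1 + (m : ℝ) / M) ^ m ≤ (Real.exp ((m : ℝ) / M)) ^ m := by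
        gcongr
        rw [add_comm]
        exact Real.add_one_le_exp _
    _ = _ := by
        rw [← Real.exp_nat_mul]
        congr 1
        ring

theorem card_filter_lt_card_inter_le {M m : ℕ} (hmM : m ≤ M) (hM : 0 < M) {S : Finset (Fin M)}
    (hS : S.card = m) (r : ℝ) :
    (((powersetCard m (univ : Finset (Fin M))).filter fun T => r < ((S ∩ T).card : ℝ)).card : ℝ) ≤
      (M.choose m : ℝ) * Real.exp ((m : ℝ) ^ 2 / M - r * Real.log 2) := by
  have h := sum_two_pow_card_inter_le hmM hM hS
  have h1 : (((powersetCard m (univ : Finset (Fin M))).filter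
      fun T => r < ((S ∩ T).card : ℝ)).card : ℝ) * Real.exp (r * Real.log 2) ≤
      ∑ T ∈ powersetCard m (univ : Finset (Fin M)), (2 : ℝ) ^ (S ∩ T).card := by
    rw [← nsmul_eq_mul]
    refine le_trans (card_nsmul_le_sum _ (fun T => (2 : ℝ) ^ (S ∩ T).card) _ fun T hT => ?_)
      (sum_le_sum_of_subset_of_nonneg (filter_subset _ _) fun _ _ _ => by positivity)
    have h2 := (mem_filter.1 hT).2
    rw [← Real.rpow_natCast, Real.rpow_def_of_pos (by norm_num), mul_comm (Real.log 2)]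
    refine Real.exp_le_exp.2 ?_
    have := Real.log_pos one_lt_two
    gcongr
  rw [Real.exp_sub, mul_div_assoc', le_div_iff₀ (Real.exp_pos _)]
  exact h1.trans h

/-- A query that detects many members of a nearly uncorrelated family has small tolerance. -/
theorem card_detected_mul_le {M : ℕ} {ι : Type*} (𝒮 : Finset ι)
    (u : ι → Hypercube M → ℝ) {τ β B t : ℝ} (hτ : 0 < τ) (ht0 : 0 ≤ t) (ht : 2 * τ ≤ t ^ 2)
    (hβ0 : 0 ≤ β) (hB0 : 0 ≤ B)
    (hβ : ∀ S ∈ 𝒮, ∀ T ∈ 𝒮, |cubeMean fun x => u S x * u T x| ≤ β)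
    (hB : ∀ S ∈ 𝒮, ((𝒮.filter fun T => τ < |cubeMean fun x => u S x * u T x|).card : ℝ) ≤ B)
    (f : Hypercube M → ℝ) (hf : ∀ x, f x ∈ Set.Icc (-1 : ℝ) 1) :
    ((𝒮.filter fun S => t < |cubeMean fun x => f x * u S x|).card : ℝ) * τ ≤ B * β := by
  set K := 𝒮.filter fun S => t < |cubeMean fun x => f x * u S x| with hK
  have hKS : K ⊆ 𝒮 := filter_subset _ _
  rcases K.eq_empty_or_nonempty with hKe | ⟨S₀, hS₀⟩
  · rw [hKe, card_empty, Nat.cast_zero, zero_mul]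
    exact mul_nonneg hB0 hβ0
  choose! s hs1 hs2 using fun a : ℝ => (show ∃ s : ℝ, |s| = 1 ∧ s * a = |a| from by
    rcases le_total 0 a with h | h
    · exact ⟨1, by norm_num, by rw [abs_of_nonneg h, one_mul]⟩
    · exact ⟨-1, by norm_num, by rw [abs_of_nonpos h]; ring⟩)
  set c : ι → ℝ := fun S => s (cubeMean fun x => f x * u S x) with hc
  set G : Hypercube M → ℝ := fun x => ∑ S ∈ K, c S * u S x with hG
  have hlow : (K.card : ℝ) * t ≤ cubeMean fun x => f x * G x := by
    have h1 : (cubeMean fun x => f x * G x) = ∑ S ∈ K, |cubeMean fun x => f x * u S x| := by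
      simp only [hG, mul_sum]
      rw [cubeMean_sum]
      refine sum_congr rfl fun S _ => ?_
      rw [← hs2, ← cubeMean_mul_left]
      congr 1
      ext x
      ring
    rw [h1, ← nsmul_eq_mul]
    exact card_nsmul_le_sum _ _ _ fun S hS => (mem_filter.1 hS).2.le
  -- Cauchy–Schwarz with `|f| ≤ 1`. Together with `hlow` and `hup` it yields `|K|t² ≤ |K|τ + Bβ`,
  -- and `t² ≥ 2τ` leaves `|K|τ ≤ Bβ`.
  have hcs : (cubeMean fun x => f x * G x) ^ 2 ≤ cubeMean fun x => G x * G x := by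
    have h1 := sum_mul_sq_le_sq_mul_sq univ f G
    have h2 : ∑ x : Hypercube M, f x ^ 2 ≤ 2 ^ M := by
      refine (sum_le_card_nsmul _ _ 1 fun x _ => ?_).trans (by simp)
      obtain ⟨h3, h4⟩ := hf x
      nlinarith
    unfold cubeMean
    rw [div_pow, sq ((2 : ℝ) ^ M), ← div_div]
    gcongr
    rw [div_le_iff₀ (by positivity), mul_comm]
    simp_rw [← sq]
    refine h1.trans ?_
    gcongr
  have hup : (cubeMean fun x => G x * G x) ≤ (K.card : ℝ) * (K.card * τ + B * β) := by
    have h1 : (cubeMean fun x => G x * G x) =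
        ∑ S ∈ K, ∑ T ∈ K, c S * c T * cubeMean fun x => u S x * u T x := by
      simp only [hG, sum_mul_sum]
      rw [cubeMean_sum]
      refine sum_congr rfl fun S _ => ?_
      rw [cubeMean_sum]
      refine sum_congr rfl fun T _ => ?_
      rw [← cubeMean_mul_left]
      congr 1
      ext x
      ring
    rw [h1, ← nsmul_eq_mul]
    refine sum_le_card_nsmul _ _ _ fun S hS => ?_
    have h2 : ∀ T ∈ K, c S * c T * (cubeMean fun x => u S x * u T x) ≤
        τ + if τ < |cubeMean fun x => u S x * u T x| then β else 0 := by
      intro T hT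
      refine (le_abs_self _).trans ?_
      rw [abs_mul, abs_mul, hs1, hs1, one_mul, one_mul]
      split_ifs with h
      · linarith [hβ S (hKS hS) T (hKS hT)]
      · linarith
    refine (sum_le_sum h2).trans ?_
    rw [sum_add_distrib, sum_const, nsmul_eq_mul, ← sum_filter, sum_const, nsmul_eq_mul]
    gcongr
    refine le_trans ?_ (hB S (hKS hS))
    exact_mod_cast card_le_card (filter_subset_filter _ hKS)
  have hKpos : (0 : ℝ) < K.card := by exact_mod_cast card_pos.2 ⟨S₀, hS₀⟩
  have h1 : ((K.card : ℝ) * t) ^ 2 ≤ (K.card : ℝ) * (K.card * τ + B * β) :=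
    (pow_le_pow_left₀ (by positivity) hlow 2).trans (hcs.trans hup)
  have h2 : (K.card : ℝ) * (K.card * t ^ 2) ≤ (K.card : ℝ) * (K.card * τ + B * β) := by
    calc _ = ((K.card : ℝ) * t) ^ 2 := by ring
      _ ≤ _ := h1
  have h3 := le_of_mul_le_mul_left h2 hKpos
  nlinarith

/-- Disposes of adaptivity: agreement along the run under `O` suffices, since equal answers lead to
the same next query. -/
theorem verdict_congr {M : ℕ} {O O' : QueryOracle M} (alg : SQAlgorithm M)
    (h : ∀ q ∈ alg.queries O, O' q = O q) : alg.verdict O' = alg.verdict O := by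
  induction alg with
  | output v => rfl
  | query q next ih =>
    simp only [SQAlgorithm.queries, List.mem_cons, forall_eq_or_imp] at h
    simp only [SQAlgorithm.verdict]
    rw [h.1]
    exact ih _ h.2

/-- If no admissible query detects more than `N` members of a family of alternatives, then a
testing algorithm has to make many queries. -/
theorem measure_pos_of_distinguishes {M : ℕ} {Ω ι : Type*} [MeasurableSpace Ω] (μ : Measure Ω)
    [IsProbabilityMeasure μ] (alg : Ω → SQAlgorithm M) {H₀ H₁ : Set (PMF (Hypercube M))}
    (hd : Distinguishes μ alg H₀ H₁) {P₀ : PMF (Hypercube M)} (hP₀ : P₀ ∈ H₀) (𝒮 : Finset ι)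
    (P : ι → PMF (Hypercube M)) (hP : ∀ S ∈ 𝒮, P S ∈ H₁) {t L N : ℝ} (hN0 : 0 ≤ N)
    (hN : ∀ q : StatQuery M, t ≤ q.tol → ((𝒮.filter fun S =>
      q.tol < |cubeExpectation P₀ q.f - cubeExpectation (P S) q.f|).card : ℝ) ≤ N)
    (hLN : 3 * (L * N) < 𝒮.card) :
    0 < μ {ω | (∃ q ∈ (alg ω).queries (fun q => cubeExpectation P₀ q.f), q.tol < t) ∨
      L ≤ (((alg ω).queries (fun q => cubeExpectation P₀ q.f)).length : ℝ)} := by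
  classical
  set O₀ : QueryOracle M := fun q => cubeExpectation P₀ q.f with hO₀
  have hO₀s : O₀.IsSTAT P₀ := fun q => by simp [hO₀, q.tol_pos.le]
  -- This oracle imitates the null whenever that is legitimate for `P S`, so the run changes only if
  -- some query detects `S`.
  set O : ι → QueryOracle M := fun S q =>
    if |cubeExpectation P₀ q.f - cubeExpectation (P S) q.f| ≤ q.tol then cubeExpectation P₀ q.f
    else cubeExpectation (P S) q.f with hO
  have hOs : ∀ S, (O S).IsSTAT (P S) := by
    intro S q
    simp only [hO]
    split_ifs with h
    · exact h
    · simp [q.tol_pos.le]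
  by_contra hcon
  have hnull := le_antisymm (not_lt.1 hcon) (zero_le)
  obtain ⟨E₀, hE₀m, hE₀, hE₀v⟩ := hd.1 P₀ hP₀ O₀ hO₀s
  have hE : ∀ S, ∃ E : Set Ω, MeasurableSet E ∧ (S ∈ 𝒮 → 2 / 3 ≤ μ E ∧
      ∀ ω ∈ E, (alg ω).verdict (O S) = Verdict.alternative) := by
    intro S
    by_cases hS : S ∈ 𝒮
    · obtain ⟨E, h1, h2, h3⟩ := hd.2 (P S) (hP S hS) (O S) (hOs S)
      exact ⟨E, h1, fun _ => ⟨h2, h3⟩⟩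
    · exact ⟨∅, MeasurableSet.empty, fun h => absurd h hS⟩
  choose E hEm hE' using hE
  -- Two events of probability `2/3` overlap in at least `1/3`. On the overlap the verdicts under
  -- `O₀` and `O S` differ, so the null run must detect `S`.
  have hG : ∀ S ∈ 𝒮, (1 / 3 : ENNReal) ≤ μ (E₀ ∩ E S) := by
    intro S hS
    have h1 := measure_union_add_inter E₀ (hEm S) (μ := μ)
    have h2 : μ (E₀ ∪ E S) ≤ 1 := prob_le_one
    have h3 : (2 / 3 : ENNReal) + 2 / 3 ≤ 1 + μ (E₀ ∩ E S) := by
      calc _ ≤ μ E₀ + μ (E S) := add_le_add hE₀ (hE' S hS).1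
        _ = _ := h1.symm
        _ ≤ _ := by gcongr
    have h4 : (2 / 3 : ENNReal) + 2 / 3 = 1 + 1 / 3 := by
      rw [ENNReal.div_add_div_same]
      have : (1 : ENNReal) = 3 / 3 := (ENNReal.div_self (by norm_num) (by norm_num)).symm
      conv_rhs => rw [this]
      rw [show (3 / 3 : ENNReal) / 3 = 1 / 3 by rw [← this], ENNReal.div_add_div_same]
      norm_num
    rw [h4] at h3
    exact (ENNReal.add_le_add_iff_left (by norm_num)).1 h3
  have hpt : ∀ᵐ ω ∂μ, ∑ S ∈ 𝒮, (E₀ ∩ E S).indicator (fun _ => (1 : ENNReal)) ω ≤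
      ENNReal.ofReal (L * N) := by
    have : ∀ᵐ ω ∂μ, ¬ ((∃ q ∈ (alg ω).queries O₀, q.tol < t) ∨
        L ≤ (((alg ω).queries O₀).length : ℝ)) := by
      rw [ae_iff]
      simpa only [not_not] using hnull
    filter_upwards [this] with ω hω
    push Not at hω
    have h1 : 𝒮.filter (fun S => ω ∈ E₀ ∩ E S) ⊆
        ((alg ω).queries O₀).toFinset.biUnion fun q => 𝒮.filter fun S =>
          q.tol < |cubeExpectation P₀ q.f - cubeExpectation (P S) q.f| := by
      intro S hS
      obtain ⟨hS, hωS⟩ := mem_filter.1 hS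
      by_contra hnot
      simp only [mem_biUnion, List.mem_toFinset, mem_filter, not_exists, not_and, not_lt] at hnot
      have h2 := verdict_congr (O := O₀) (O' := O S) (alg ω) fun q hq => by
        simp only [hO, hO₀]
        rw [if_pos (hnot q hq hS)]
      rw [hE₀v ω hωS.1, (hE' S hS).2 ω hωS.2] at h2
      cases h2
    have h2 : ((𝒮.filter fun S => ω ∈ E₀ ∩ E S).card : ℝ) ≤ L * N := by
      calc ((𝒮.filter fun S => ω ∈ E₀ ∩ E S).card : ℝ)
          ≤ ∑ q ∈ ((alg ω).queries O₀).toFinset, ((𝒮.filter fun S =>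
            q.tol < |cubeExpectation P₀ q.f - cubeExpectation (P S) q.f|).card : ℝ) := by
            exact_mod_cast (card_le_card h1).trans card_biUnion_le
        _ ≤ ∑ q ∈ ((alg ω).queries O₀).toFinset, N :=
            sum_le_sum fun q hq => hN q (hω.1 q (List.mem_toFinset.1 hq))
        _ = (((alg ω).queries O₀).toFinset.card : ℝ) * N := by rw [sum_const, nsmul_eq_mul]
        _ ≤ (((alg ω).queries O₀).length : ℝ) * N := by
            gcongr
            exact List.toFinset_card_le _
        _ ≤ L * N := by gcongr; exact hω.2.le
    have h3 : ∑ S ∈ 𝒮, (E₀ ∩ E S).indicator (fun _ => (1 : ENNReal)) ω =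
        ((𝒮.filter fun S => ω ∈ E₀ ∩ E S).card : ENNReal) := by
      simp only [Set.indicator_apply]
      rw [sum_ite, sum_const_zero, add_zero, sum_const, nsmul_eq_mul, mul_one]
    rw [h3, ← ENNReal.ofReal_natCast]
    exact ENNReal.ofReal_le_ofReal h2
  have hint := lintegral_mono_ae hpt
  rw [lintegral_finsetSum' _ fun S _ => (aemeasurable_const.indicator (hE₀m.inter (hEm S)))] at hint
  simp only [lintegral_indicator_const (hE₀m.inter (hEm _)), one_mul, lintegral_const,
    measure_univ, mul_one] at hint
  have h5 := (sum_le_sum hG).trans hint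
  rw [sum_const, nsmul_eq_mul] at h5
  have h6 : ((𝒮.card : ENNReal)) * (1 / 3) = ENNReal.ofReal ((𝒮.card : ℝ) / 3) := by
    rw [ENNReal.ofReal_div_of_pos (by norm_num), ENNReal.ofReal_natCast, mul_one_div]
    norm_num
  rw [h6] at h5
  -- An empty family would force `L * N < 0`, whereas `L` exceeds the length of some run and `N` is
  -- nonnegative.
  have hcard : (0 : ℝ) < 𝒮.card := by
    by_contra hneg
    have h0 : 𝒮.card = 0 := by
      have : (𝒮.card : ℝ) ≤ 0 := not_lt.1 hneg
      exact_mod_cast le_antisymm this (Nat.cast_nonneg _)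
    have hnull' : ∀ᵐ ω ∂μ, ¬ ((∃ q ∈ (alg ω).queries O₀, q.tol < t) ∨
        L ≤ (((alg ω).queries O₀).length : ℝ)) := by
      rw [ae_iff]
      simpa only [not_not] using hnull
    obtain ⟨ω, hω⟩ := hnull'.exists
    push Not at hω
    have hL : 0 < L := lt_of_le_of_lt (Nat.cast_nonneg _) hω.2
    rw [h0, Nat.cast_zero] at hLN
    nlinarith [mul_nonneg hL.le hN0]
  by_cases hLN0 : 0 ≤ L * N
  · rw [ENNReal.ofReal_le_ofReal_iff hLN0] at h5
    linarith
  · rw [ENNReal.ofReal_of_nonpos (not_le.1 hLN0).le] at h5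
    have := ENNReal.ofReal_eq_zero.1 (le_antisymm h5 zero_le)
    linarith

end IsingSQ

/-! ### The clique model and its moment-matching perturbations as distributions. -/

namespace IsingSQ

open Finset

theorem two_pow_eq_card (M : ℕ) : (Fintype.card (Hypercube M) : ℝ) = 2 ^ M := by
  simp [Hypercube]

theorem uniformOfFintype_apply_toReal {M : ℕ} (x : Hypercube M) :
    (PMF.uniformOfFintype (Hypercube M) x).toReal = 1 / 2 ^ M := by
  rw [PMF.uniformOfFintype_apply, ENNReal.toReal_inv, ENNReal.toReal_natCast, two_pow_eq_card,
    one_div]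

/-- The distribution on the cube with density `F` relative to the uniform distribution. -/
noncomputable def densityPMF {M : ℕ} (F : Hypercube M → ℝ) (h0 : ∀ x, 0 ≤ F x)
    (h1 : cubeMean F = 1) : PMF (Hypercube M) :=
  PMF.ofFintype (fun x => ENNReal.ofReal (F x / 2 ^ M)) (by
    rw [← ENNReal.ofReal_sum_of_nonneg fun x _ => div_nonneg (h0 x) (by positivity), ← sum_div]
    change ENNReal.ofReal (cubeMean F) = 1
    rw [h1, ENNReal.ofReal_one])

theorem densityPMF_apply_toReal {M : ℕ} {F : Hypercube M → ℝ} (h0 : ∀ x, 0 ≤ F x)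
    (h1 : cubeMean F = 1) (x : Hypercube M) :
    (densityPMF F h0 h1 x).toReal = F x / 2 ^ M := by
  unfold densityPMF
  rw [PMF.ofFintype_apply, ENNReal.toReal_ofReal (div_nonneg (h0 x) (by positivity))]

theorem tvDistance_eq_cubeMean {M : ℕ} {P Q : PMF (Hypercube M)} {F G : Hypercube M → ℝ}
    (hP : ∀ x, (P x).toReal = F x / 2 ^ M) (hQ : ∀ x, (Q x).toReal = G x / 2 ^ M) :
    tvDistance P Q = (1 / 2) * cubeMean fun x => |F x - G x| := by
  unfold tvDistance cubeMean
  rw [sum_div]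
  congr 1
  refine sum_congr rfl fun x _ => ?_
  rw [hP, hQ, ← sub_div, abs_div, abs_of_pos (by positivity : (0 : ℝ) < 2 ^ M)]

theorem cubeExpectation_eq_cubeMean {M : ℕ} {P : PMF (Hypercube M)} {F : Hypercube M → ℝ}
    (hP : ∀ x, (P x).toReal = F x / 2 ^ M) (f : Hypercube M → ℝ) :
    cubeExpectation P f = cubeMean fun x => f x * F x := by
  unfold cubeExpectation cubeMean
  rw [sum_div]
  refine sum_congr rfl fun x _ => ?_
  rw [hP]
  ring

/-- The term `-|S|` removes the diagonal of the squared sum; being constant in `x`, it disappears on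
normalisation. -/
theorem cliqueInteraction_form {M : ℕ} (S : Finset (Fin M)) (b : ℝ) (x : Hypercube M) :
    ∑ i, ∑ j, (-1 : ℝ) ^ ((x i : ℕ) + (x j : ℕ)) * (cliqueInteraction S b).entry i j =
      b * ((∑ i ∈ S, sgn x i) ^ 2 - S.card) := by
  have h1 : ∀ i j, (-1 : ℝ) ^ ((x i : ℕ) + (x j : ℕ)) * (cliqueInteraction S b).entry i j =
      (if i ∈ S then if j ∈ S then b * (sgn x i * sgn x j) else 0 else 0) -
      if i = j then if i ∈ S then b else 0 else 0 := by
    intro i j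
    simp only [cliqueInteraction, Matrix.of_apply]
    by_cases hij : i = j
    · subst hij
      by_cases hi : i ∈ S
      · simp [hi, sgn_mul_self]
      · simp [hi]
    · by_cases hi : i ∈ S <;> by_cases hj : j ∈ S
      · simp only [hij, hi, hj, sgn, pow_add, ne_eq, not_false_eq_true, and_self, if_true, if_false]
        ring
      all_goals simp [hij, hi, hj]
  simp_rw [h1, sum_sub_distrib]
  simp only [sum_ite_eq, mem_univ, if_true, sum_ite_mem, univ_inter, sum_const, nsmul_eq_mul]
  have h2 : ∑ i, (if i ∈ S then ∑ j ∈ S, b * (sgn x i * sgn x j) else 0) =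
      b * (∑ i ∈ S, sgn x i) ^ 2 := by
    rw [sum_ite_mem, univ_inter, sq, sum_mul_sum, mul_sum]
    simp_rw [mul_sum]
  have h3 : ∀ i, (∑ j, if i ∈ S then if j ∈ S then b * (sgn x i * sgn x j) else 0 else 0) =
      if i ∈ S then ∑ j ∈ S, b * (sgn x i * sgn x j) else 0 := by
    intro i
    split_ifs
    · rw [sum_ite_mem, univ_inter]
    · simp
  simp_rw [h3, h2]
  ring

theorem cliqueIsing_apply_toReal {M m : ℕ} (hm : 0 < m) {S : Finset (Fin M)} (hS : S.card = m)
    (δ : ℝ) (x : Hypercube M) :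
    (cliqueIsing S (δ / m) x).toReal = cliqueDensity m δ (weight S x) / 2 ^ M := by
  have hmR : (0 : ℝ) < m := by exact_mod_cast hm
  have hw : ∀ x, isingWeight (cliqueInteraction S (δ / m)) x =
      Real.exp (-(δ / 2)) * Real.exp (δ * stdz m (weight S x) ^ 2 / 2) := by
    intro x
    unfold isingWeight
    rw [cliqueInteraction_form, sum_sgn, hS, ← Real.exp_add]
    congr 1
    rw [stdz, div_pow, Real.sq_sqrt hmR.le]
    field_simp
    ring
  have hsum : ∑ x, isingWeight (cliqueInteraction S (δ / m)) x =
      Real.exp (-(δ / 2)) * cliqueNorm m δ * 2 ^ M := by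
    simp_rw [hw]
    rw [← mul_sum]
    have := cubeMean_weight S fun j => Real.exp (δ * stdz m j ^ 2 / 2)
    rw [hS] at this
    unfold cliqueNorm
    rw [← this]
    unfold cubeMean
    field_simp
  have hpos : ∀ x, 0 ≤ isingWeight (cliqueInteraction S (δ / m)) x := fun x => (Real.exp_pos _).le
  unfold cliqueIsing isingModel
  rw [PMF.normalize_apply, ENNReal.toReal_mul, ENNReal.toReal_inv, tsum_fintype,
    ← ENNReal.ofReal_sum_of_nonneg fun x _ => hpos x,
    ENNReal.toReal_ofReal (sum_nonneg fun x _ => hpos x), ENNReal.toReal_ofReal (hpos x), hsum, hw,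
    cliqueDensity, mul_inv, mul_inv]
  have := Real.exp_pos (-(δ / 2))
  field_simp

/-- For small `δ` the uniform distribution is itself close to the Ising model. -/
theorem tvDistance_uniform_cliqueIsing_le {M m : ℕ} (hm : 0 < m) {S : Finset (Fin M)}
    (hS : S.card = m) {δ : ℝ} (h0 : 0 ≤ δ) (h1 : δ ≤ 1 / 32) :
    tvDistance (PMF.uniformOfFintype (Hypercube M)) (cliqueIsing S (δ / m)) ≤ 60 * δ := by
  rw [tvDistance_eq_cubeMean uniformOfFintype_apply_toReal (cliqueIsing_apply_toReal hm hS δ)]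
  have h := cubeMean_weight S fun j => |1 - cliqueDensity m δ j|
  rw [hS] at h
  rw [h]
  simp_rw [abs_sub_comm (1 : ℝ)]
  linarith [binMean_abs_cliqueDensity_sub_one_le hm h0 h1]

/-- A test of uniformity against alternatives that contain a moment-matching density makes many
queries or a query of small tolerance. -/
theorem measure_pos_of_moment_matching {M m k : ℕ} (hm : 0 < m) (hmM : m ≤ M) {δ ε : ℝ}
    {g : ℕ → ℝ} (hg0 : ∀ j, 0 ≤ g j)
    (hgε : binMean m (fun j => |g j - cliqueDensity m δ j|) ≤ 2 * ε)
    (hgk : ∀ n ≤ k, binMean m (fun j => (g j - 1) * ((m : ℝ) - 2 * j) ^ n) = 0)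
    {β τ r L : ℝ} (hgβ : binMean m (fun j => (g j - 1) ^ 2) ≤ β) (hτ : 0 < τ)
    (hrτ : (r / m) ^ (k + 1) * β ≤ τ)
    (hL : 3 * (L * (Real.exp ((m : ℝ) ^ 2 / M - r * Real.log 2) * β / τ)) < 1)
    {Ω : Type*} [MeasurableSpace Ω] (μ : MeasureTheory.Measure Ω)
    [MeasureTheory.IsProbabilityMeasure μ] (alg : Ω → SQAlgorithm M)
    (hd : Distinguishes μ alg (uniformHypothesis M) (corruptedIsingHypothesis M m (δ / m) ε)) :
    0 < μ {ω | (∃ q ∈ (alg ω).queries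
        (fun q => cubeExpectation (PMF.uniformOfFintype (Hypercube M)) q.f),
        q.tol < Real.sqrt (2 * τ)) ∨
      L ≤ (((alg ω).queries
        (fun q => cubeExpectation (PMF.uniformOfFintype (Hypercube M)) q.f)).length : ℝ)} := by
  classical
  have hM : 0 < M := hm.trans_le hmM
  have hmR : (0 : ℝ) < m := by exact_mod_cast hm
  have hβ0 : 0 ≤ β := (binMean_nonneg fun j _ => sq_nonneg _).trans hgβ
  have hg1 : binMean m g = 1 := by
    have := hgk 0 (Nat.zero_le _)
    simp only [pow_zero, mul_one] at this
    rw [binMean_sub, binMean_const] at this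
    linarith
  have hmean : ∀ S : Finset (Fin M), S.card = m → cubeMean (fun x => g (weight S x)) = 1 := by
    intro S hS
    rw [cubeMean_weight, hS, hg1]
  set P : Finset (Fin M) → PMF (Hypercube M) := fun S =>
    if h : S.card = m then densityPMF (fun x => g (weight S x)) (fun _ => hg0 _) (hmean S h)
    else PMF.uniformOfFintype _ with hP
  have hPapply : ∀ S : Finset (Fin M), S.card = m → ∀ x,
      (P S x).toReal = g (weight S x) / 2 ^ M := by
    intro S hS x
    simp only [hP, hS, dif_pos]
    exact densityPMF_apply_toReal _ (hmean S hS) x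
  set 𝒮 := powersetCard m (univ : Finset (Fin M)) with h𝒮
  have hmem : ∀ S ∈ 𝒮, S.card = m := fun S hS => (mem_powersetCard.1 hS).2
  have hcard : (𝒮.card : ℝ) = M.choose m := by
    rw [h𝒮, card_powersetCard, card_univ, Fintype.card_fin]
  have hcpos : (0 : ℝ) < M.choose m := by exact_mod_cast Nat.choose_pos hmM
  set B : ℝ := (M.choose m : ℝ) * Real.exp ((m : ℝ) ^ 2 / M - r * Real.log 2) with hB
  have hB0 : 0 ≤ B := by positivity
  have hcor : ∀ S ∈ 𝒮, ∀ T ∈ 𝒮,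
      |cubeMean fun x => (g (weight S x) - 1) * (g (weight T x) - 1)| ≤
        (((S ∩ T).card : ℝ) / m) ^ (k + 1) * β := by
    intro S hS T hT
    refine (abs_cubeMean_mul_weight_le hm (hmem S hS) (hmem T hT) (fun j => g j - 1) hgk).trans ?_
    gcongr
  -- `B` bounds the sets `T` that meet a fixed `S` in more than `r` points; for the others `hrτ`
  -- makes the correlation at most `τ`.
  refine measure_pos_of_distinguishes μ alg hd (Set.mem_singleton _) 𝒮 P ?_
    (N := B * β / τ) (by positivity) ?_ ?_
  · intro S hS
    refine ⟨S, hmem S hS, ?_⟩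
    rw [tvDistance_eq_cubeMean (hPapply S (hmem S hS)) (cliqueIsing_apply_toReal hm (hmem S hS) δ)]
    have h := cubeMean_weight S fun j => |g j - cliqueDensity m δ j|
    rw [hmem S hS] at h
    rw [h]
    linarith
  · intro q hq
    have ht : 2 * τ ≤ q.tol ^ 2 := by
      rw [← Real.sq_sqrt (by positivity : 0 ≤ 2 * τ)]
      exact pow_le_pow_left₀ (Real.sqrt_nonneg _) hq 2
    have hdiff : ∀ S ∈ 𝒮,
        |cubeExpectation (PMF.uniformOfFintype (Hypercube M)) q.f - cubeExpectation (P S) q.f| =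
        |cubeMean fun x => q.f x * (g (weight S x) - 1)| := by
      intro S hS
      rw [cubeExpectation_eq_cubeMean uniformOfFintype_apply_toReal,
        cubeExpectation_eq_cubeMean (hPapply S (hmem S hS)), abs_sub_comm]
      congr 1
      unfold cubeMean
      rw [← sub_div, ← sum_sub_distrib]
      congr 1
      exact sum_congr rfl fun x _ => by ring
    have h := card_detected_mul_le 𝒮 (fun S x => g (weight S x) - 1) hτ q.tol_pos.le ht hβ0 hB0
      (fun S hS T hT => (hcor S hS T hT).trans (mul_le_of_le_one_left hβ0
        (pow_le_one₀ (by positivity) (by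
          rw [div_le_one hmR]
          exact_mod_cast (hmem S hS) ▸ card_le_card inter_subset_left))))
      (fun S hS => ?_) q.f q.mem_Icc
    · rw [le_div_iff₀ hτ]
      rwa [filter_congr fun S hS => by rw [hdiff S hS]]
    · refine le_trans ?_ (card_filter_lt_card_inter_le hmM hM (hmem S hS) r)
      refine Nat.cast_le.2 (card_le_card fun T hT => ?_)
      obtain ⟨hT, hTτ⟩ := mem_filter.1 hT
      refine mem_filter.2 ⟨hT, ?_⟩
      by_contra hle
      have h1 := (hcor S hS T hT).trans (le_trans ?_ hrτ)
      · exact absurd hTτ (not_lt.2 h1)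
      · have := not_lt.1 hle
        gcongr
  · rw [hcard]
    calc 3 * (L * (B * β / τ)) = (M.choose m : ℝ) *
          (3 * (L * (Real.exp ((m : ℝ) ^ 2 / M - r * Real.log 2) * β / τ))) := by
          rw [hB]; ring
      _ < (M.choose m : ℝ) * 1 := by gcongr
      _ = _ := mul_one _

end IsingSQ

/-! ### Choice of parameters. -/

namespace IsingSQ

theorem not_distinguishes_of_mem_inter {M : ℕ} {Ω : Type*} [MeasurableSpace Ω]
    (μ : MeasureTheory.Measure Ω) [MeasureTheory.IsProbabilityMeasure μ] (alg : Ω → SQAlgorithm M)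
    {H₀ H₁ : Set (PMF (Hypercube M))} {P : PMF (Hypercube M)} (h0 : P ∈ H₀) (h1 : P ∈ H₁) :
    ¬ Distinguishes μ alg H₀ H₁ := by
  intro hd
  set O : QueryOracle M := fun q => cubeExpectation P q.f with hO
  have hOs : O.IsSTAT P := fun q => by simp [hO, q.tol_pos.le]
  obtain ⟨E, hEm, hE, hEv⟩ := hd.1 P h0 O hOs
  obtain ⟨F, hFm, hF, hFv⟩ := hd.2 P h1 O hOs
  have hdisj : Disjoint E F := Set.disjoint_left.2 fun ω hω hω' => by
    have := (hEv ω hω).symm.trans (hFv ω hω')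
    cases this
  have h2 := MeasureTheory.measure_union hdisj hFm (μ := μ)
  have h3 : μ (E ∪ F) ≤ 1 := MeasureTheory.prob_le_one
  have h4 : (2 / 3 : ENNReal) + 2 / 3 ≤ 1 := (add_le_add hE hF).trans (h2 ▸ h3)
  rw [ENNReal.div_add_div_same, ENNReal.div_le_iff (by norm_num) (by norm_num)] at h4
  norm_num at h4

theorem mul_log_one_div_le_one {ε : ℝ} (h0 : 0 < ε) : ε * Real.log (1 / ε) ≤ 1 := by
  have h := Real.log_le_sub_one_of_pos (one_div_pos.2 h0)
  have h2 : ε * Real.log (1 / ε) ≤ ε * (1 / ε - 1) := by gcongr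
  have h3 : ε * (1 / ε - 1) = 1 - ε := by field_simp
  linarith

/-- The moment-matching density for the parameters of the lower bound. -/
theorem exists_density_of_params {m k : ℕ} (hk : 1 ≤ k) (hm : 0 < m) {δ ε : ℝ} (h0 : 0 < δ)
    (hε : 0 < ε) (hεδ : ε < 60 * δ)
    (hδ : δ ≤ 1 / 60000 * (ε * Real.log (1 / ε) / (k : ℝ) ^ 3))
    (hmL : 5000 * Real.log (1 / ε) ^ 3 < m) :
    ∃ g : ℕ → ℝ, (∀ j, 0 ≤ g j) ∧ binMean m (fun j => |g j - cliqueDensity m δ j|) ≤ 2 * ε ∧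
      binMean m (fun j => (g j - 1) ^ 2) ≤ 720 * δ ∧
      ∀ n ≤ k, binMean m (fun j => (g j - 1) * ((m : ℝ) - 2 * j) ^ n) = 0 := by
  set L := Real.log (1 / ε) with hL
  have hk1 : (1 : ℝ) ≤ k := by exact_mod_cast hk
  have hk3 : (1 : ℝ) ≤ (k : ℝ) ^ 3 := one_le_pow₀ hk1
  have hkk3 : (k : ℝ) ≤ (k : ℝ) ^ 3 := le_self_pow₀ hk1 (by norm_num)
  have hδ' : 60000 * δ * (k : ℝ) ^ 3 ≤ ε * L := by
    rw [one_div_mul_eq_div, div_div, le_div_iff₀ (by positivity)] at hδ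
    linarith
  -- Combines `60000δk³ ≤ εL` with `ε < 60δ`.
  have hLk : 1000 * (k : ℝ) ^ 3 ≤ L := by
    by_contra hcon
    have h1 : ε * L ≤ ε * (1000 * (k : ℝ) ^ 3) := by gcongr; exact (not_le.1 hcon).le
    have h2 : ε * (1000 * (k : ℝ) ^ 3) < 60 * δ * (1000 * (k : ℝ) ^ 3) := by gcongr
    linarith
  have hL1 : 1000 ≤ L := by linarith
  have hεL : ε * L ≤ 1 := mul_log_one_div_le_one hε
  have hδ1 : δ ≤ 1 / 48 := by nlinarith
  -- With this `R`, `exp(-R²) = ε^(1/4)`, far above `ε`, while `R²` remains a constant multiple of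
  -- `log(1/ε)`, as the bound on `δ` requires.
  set R := Real.sqrt L / 2 with hR
  have hsL : 1 ≤ Real.sqrt L := Real.one_le_sqrt.2 (by linarith)
  have hR2 : R ^ 2 = L / 4 := by
    rw [hR, div_pow, Real.sq_sqrt (by linarith)]; norm_num
  have hR0 : 0 < R := by rw [hR]; linarith
  have hmR : (0 : ℝ) < m := by exact_mod_cast hm
  have hL3 : L ≤ L ^ 3 := le_self_pow₀ (by linarith) (by norm_num)
  set w := R / (4 * (k : ℝ) ^ 3) with hw
  have hw0 : 0 < w := by rw [hw]; positivity
  obtain ⟨g, hg⟩ := exists_moment_matching_density (k := k) (R := R) (w := w) hm h0.le hδ1 hε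
    (by rw [hR2]; linarith)
    (by
      refine Real.le_sqrt_of_sq_le ?_
      rw [mul_pow, hR2]
      linarith)
    (by
      rw [hR2]
      have : 0 ≤ δ * (k : ℝ) ^ 3 := by positivity
      linarith)
    hw0
    (by rw [hw]; exact div_le_self hR0.le (by linarith))
    (by
      have h1 : w * Real.sqrt m = Real.sqrt (w ^ 2 * m) := by
        rw [Real.sqrt_mul (sq_nonneg w), Real.sqrt_sq hw0.le]
      rw [h1]
      refine Real.le_sqrt_of_sq_le ?_
      rw [hw, div_pow, hR2, div_mul_eq_mul_div, le_div_iff₀ (by positivity)]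
      have h2 : ((k : ℝ) ^ 3) ^ 2 ≤ L ^ 2 := by gcongr; linarith
      have h4 : L * (5000 * L ^ 3) ≤ L * m := by gcongr
      have h5 : L ^ 2 ≤ L ^ 4 := pow_le_pow_right₀ (by linarith) (by norm_num)
      nlinarith)
    (by rw [hw]; field_simp; exact le_refl _)
    (by
      have hεe : ε = Real.exp (-L) := by
        rw [hL, one_div, Real.log_inv, neg_neg, Real.exp_log hε]
      have h1 : Real.exp (-R ^ 2) = ε * Real.exp (3 * L / 4) := by
        rw [hR2, hεe, ← Real.exp_add]; congr 1; ring
      have h2 : 256 * L ≤ Real.exp (3 * L / 4) := by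
        have := Real.quadratic_le_exp_of_nonneg (x := 3 * L / 4) (by linarith)
        nlinarith
      have h3 : 4 ≤ w / 8 * Real.exp (3 * L / 4) := by
        calc (4 : ℝ) ≤ (1 / 2) / (4 * (k : ℝ) ^ 3) / 8 * (256 * L) := by
              rw [div_div, div_mul_eq_mul_div, le_div_iff₀ (by positivity)]
              linarith
          _ ≤ w / 8 * Real.exp (3 * L / 4) := by
              rw [hw]
              gcongr
              rw [hR]; linarith
      rw [h1]
      nlinarith)
  exact ⟨g, hg.1, hg.2.1, hg.2.2.1.trans (by linarith), hg.2.2.2⟩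

/-- Here `z = m^(1/4)` and `v = M^(1/5)`. Since `1/3 - (3/5)·log 2 < -0.08`, the intersection tail
beats the query count `2^(v²/100)` by `exp(-0.06z³)`. The powers of `v` cancel against those in `τ`,
and the constant left over is below `exp(0.06z³)`. -/
theorem query_budget_lt {A δ τ v z : ℝ} {n : ℕ} (hA : 0 < A) (hδ : 0 < δ) (hτ0 : 0 < τ)
    (hv0 : 0 < v) (hz1 : 1 ≤ z) (hvz : v ≤ 5 / 4 * z) (hAz : 40000 / A ≤ z ^ 3)
    (hτ : A * ((v ^ n)⁻¹ * δ) ≤ τ) :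
    3 * ((2 : ℝ) ^ ((1 / 100 : ℝ) * v ^ 2) * (v ^ n)⁻¹ *
      (Real.exp (z ^ 3 / 3 - 3 / 5 * z ^ 3 * Real.log 2) * (720 * δ) / τ)) < 1 := by
  have hl2 := Real.log_two_gt_d9
  have hl2' := Real.log_two_lt_d9
  have hz3 : 0 < z ^ 3 := by positivity
  have h2 : Real.exp (z ^ 3 / 3 - 3 / 5 * z ^ 3 * Real.log 2) ≤
      Real.exp (-(8 / 100) * z ^ 3) := by
    refine Real.exp_le_exp.2 ?_
    have : 0.6931471803 * z ^ 3 ≤ Real.log 2 * z ^ 3 := by gcongr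
    linarith
  have h3 : (2 : ℝ) ^ ((1 / 100 : ℝ) * v ^ 2) ≤ Real.exp (2 / 100 * z ^ 3) := by
    rw [Real.rpow_def_of_pos (by norm_num)]
    refine Real.exp_le_exp.2 ?_
    have h4 : v ^ 2 ≤ (5 / 4 * z) ^ 2 := by gcongr
    have h5 : z ^ 2 ≤ z ^ 3 := pow_le_pow_right₀ hz1 (by norm_num)
    have h6 : Real.log 2 * v ^ 2 ≤ 1 * v ^ 2 := by
      gcongr
      linarith
    rw [mul_pow] at h4
    linarith
  have hp : 0 < v ^ n := by positivity
  generalize v ^ n = p at hτ hp ⊢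
  have h4 : 720 * δ / τ ≤ 720 / A * p := by
    rw [div_le_iff₀ hτ0]
    calc 720 * δ = 720 / A * p * (A * (p⁻¹ * δ)) := by field_simp
      _ ≤ _ := by gcongr
  have h5 : 2160 / A < Real.exp (6 / 100 * z ^ 3) := by
    have h6 := Real.add_one_le_exp (6 / 100 * z ^ 3)
    have h7 : 40000 / A = 2160 / A * (40000 / 2160) := by ring
    have h8 : 0 < 2160 / A := by positivity
    rw [h7] at hAz
    linarith
  calc 3 * ((2 : ℝ) ^ ((1 / 100 : ℝ) * v ^ 2) * p⁻¹ *
        (Real.exp (z ^ 3 / 3 - 3 / 5 * z ^ 3 * Real.log 2) * (720 * δ) / τ))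
      = 3 * ((2 : ℝ) ^ ((1 / 100 : ℝ) * v ^ 2) * p⁻¹ *
        (Real.exp (z ^ 3 / 3 - 3 / 5 * z ^ 3 * Real.log 2) * (720 * δ / τ))) := by
        rw [mul_div_assoc]
    _ ≤ 3 * (Real.exp (2 / 100 * z ^ 3) * p⁻¹ *
        (Real.exp (-(8 / 100) * z ^ 3) * (720 / A * p))) := by gcongr
    _ = (2160 / A) * (Real.exp (2 / 100 * z ^ 3) * Real.exp (-(8 / 100) * z ^ 3)) := by
        generalize Real.exp (2 / 100 * z ^ 3) = a
        generalize Real.exp (-(8 / 100) * z ^ 3) = b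
        field_simp
        ring
    _ = (2160 / A) * Real.exp (-(6 / 100 * z ^ 3)) := by
        rw [← Real.exp_add]
        congr 2
        ring
    _ < Real.exp (6 / 100 * z ^ 3) * Real.exp (-(6 / 100 * z ^ 3)) := by
        gcongr
    _ = 1 := by rw [← Real.exp_add, add_neg_cancel, Real.exp_zero]

theorem measure_pos_of_params {A : ℝ} (hA : 0 < A) {k : ℕ} (hk : 1 ≤ k)
    (hkA : 40000 / A ≤ k) (hkA' : (3 / 4 : ℝ) ^ (k + 1) * 720 ≤ A) {m M : ℕ} {ε δ τ : ℝ}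
    (hm : 0 < m) (hM : (M : ℝ) = 3 * (m : ℝ) ^ ((5 : ℝ) / 4)) (hε : 0 < ε) (hδ0 : 0 < δ)
    (hεδ : ε < 60 * δ)
    (hδ : δ ≤ 1 / 60000 * (ε * Real.log (1 / ε) / (k : ℝ) ^ 3))
    (hτ : A * ((M : ℝ) ^ (-((k : ℝ) + 1) / 5) * δ) ≤ τ)
    (hmL : 5000 * Real.log (1 / ε) ^ 3 < m) (hmk : (k : ℝ) ^ 4 ≤ m)
    {Ω : Type*} [MeasurableSpace Ω] (μ : MeasureTheory.Measure Ω)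
    [MeasureTheory.IsProbabilityMeasure μ] (alg : Ω → SQAlgorithm M)
    (hd : Distinguishes μ alg (uniformHypothesis M) (corruptedIsingHypothesis M m (δ / m) ε)) :
    0 < μ {ω | (∃ q ∈ (alg ω).queries
        (fun q => cubeExpectation (PMF.uniformOfFintype (Hypercube M)) q.f),
        q.tol < Real.sqrt (2 * τ)) ∨
      (2 : ℝ) ^ ((1 / 100 : ℝ) * (M : ℝ) ^ ((2 : ℝ) / 5)) * (M : ℝ) ^ (-((k : ℝ) + 1) / 5) ≤
      (((alg ω).queries
        (fun q => cubeExpectation (PMF.uniformOfFintype (Hypercube M)) q.f)).length : ℝ)} := by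
  have hmR : (1 : ℝ) ≤ m := by exact_mod_cast hm
  obtain ⟨z, hz1, hmz, hMz⟩ : ∃ z : ℝ, 1 ≤ z ∧ (m : ℝ) = z ^ 4 ∧ (M : ℝ) = 3 * z ^ 5 := by
    refine ⟨(m : ℝ) ^ ((1 : ℝ) / 4), Real.one_le_rpow hmR (by norm_num), ?_, ?_⟩
    · rw [← Real.rpow_natCast, ← Real.rpow_mul (by linarith)]; norm_num
    · rw [hM, ← Real.rpow_natCast, ← Real.rpow_mul (by linarith)]; norm_num
  have hMR : (0 : ℝ) < M := by rw [hMz]; positivity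
  obtain ⟨v, hv0, hv5, hv2, hvk⟩ : ∃ v : ℝ, 0 < v ∧ v ^ 5 = M ∧ (M : ℝ) ^ ((2 : ℝ) / 5) = v ^ 2 ∧
      (M : ℝ) ^ (-((k : ℝ) + 1) / 5) = (v ^ (k + 1))⁻¹ := by
    refine ⟨(M : ℝ) ^ ((1 : ℝ) / 5), by positivity, ?_, ?_, ?_⟩
    · rw [← Real.rpow_natCast, ← Real.rpow_mul hMR.le]; norm_num
    · rw [← Real.rpow_natCast, ← Real.rpow_mul hMR.le]; norm_num
    · rw [← Real.rpow_natCast, ← Real.rpow_mul hMR.le, ← Real.rpow_neg hMR.le]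
      congr 1
      push_cast
      ring
  have hvz : v ≤ 5 / 4 * z := by
    refine le_of_pow_le_pow_left₀ (n := 5) (by norm_num) (by positivity) ?_
    rw [hv5, hMz, mul_pow]
    gcongr
    norm_num
  have hz0 : 0 < z := by linarith
  have hz3k : (k : ℝ) ≤ z ^ 3 := by
    refine le_of_pow_le_pow_left₀ (n := 4) (by norm_num) (by positivity) (hmk.trans ?_)
    rw [hmz, ← pow_mul]
    exact pow_le_pow_right₀ hz1 (by norm_num)
  have hmM : m ≤ M := by
    have : (m : ℝ) ≤ M := by
      rw [hmz, hMz]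
      have : z ^ 4 ≤ z ^ 5 := pow_le_pow_right₀ hz1 (by norm_num)
      nlinarith [(by positivity : 0 < z ^ 5)]
    exact_mod_cast this
  rw [hvk] at hτ ⊢
  rw [hv2]
  have hvp : 0 < v ^ (k + 1) := by positivity
  have hτ0 : 0 < τ := lt_of_lt_of_le (by positivity) hτ
  obtain ⟨g, hg0, hgε, hgβ, hgk⟩ := exists_density_of_params hk hm hδ0 hε hεδ hδ hmL
  -- The threshold `r` lies far enough above the mean intersection `z³/3` for the tail to decay, yet
  -- `r/m ≤ (3/4)/v` because `3^(1/5) < 5/4`. The spare factor `(3/4)^(k+1)` absorbs `720/A`.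
  refine measure_pos_of_moment_matching (β := 720 * δ) (r := 3 / 5 * z ^ 3) hm hmM hg0 hgε hgk hgβ
    hτ0 ?_ ?_ μ alg hd
  · refine le_trans ?_ hτ
    have h1 : 3 / 5 * z ^ 3 / m ≤ 3 / 4 / v := by
      rw [hmz, div_le_div_iff₀ (by positivity) hv0]
      nlinarith [mul_le_mul_of_nonneg_left hvz (by positivity : 0 ≤ z ^ 3)]
    calc (3 / 5 * z ^ 3 / m) ^ (k + 1) * (720 * δ) ≤ (3 / 4 / v) ^ (k + 1) * (720 * δ) := by
          gcongr
      _ = ((3 / 4) ^ (k + 1) * 720) * ((v ^ (k + 1))⁻¹ * δ) := by rw [div_pow]; ring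
      _ ≤ _ := by gcongr
  · have h1 : (m : ℝ) ^ 2 / M = z ^ 3 / 3 := by
      rw [hmz, hMz]; field_simp
    rw [h1]
    refine query_budget_lt hA hδ0 hτ0 hv0 hz1 hvz ?_ hτ
    exact hkA.trans hz3k

end IsingSQ

theorem theorem5p3 (A : ℝ) (hA : 0 < A) :
    -- constants that depend only on the constant `A` hidden in `τ = Θ(M^{-(k+1)/5} δ)`
    ∃ (k₀ : ℕ) (c₀ C' a : ℝ), 0 < c₀ ∧ 0 < C' ∧ 0 < a ∧
      ∀ (k : ℕ), k₀ ≤ k → ∀ (m M : ℕ) (ε δ τ : ℝ),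
        0 < m →
        (M : ℝ) = 3 * (m : ℝ) ^ ((5 : ℝ) / 4) →
        0 < ε → ε < 1 / 2 →
        0 < δ → δ ≤ c₀ * (ε * Real.log (1 / ε) / (k : ℝ) ^ 3) →
        A * ((M : ℝ) ^ (-((k : ℝ) + 1) / 5) * δ) ≤ τ →
        max (C' * Real.log (1 / ε) ^ 3) ((k : ℝ) ^ 2 / Real.log (1 / δ)) < (m : ℝ) →
        ∀ (Ω : Type*) [MeasurableSpace Ω] (μ : MeasureTheory.Measure Ω)
          [MeasureTheory.IsProbabilityMeasure μ] (alg : Ω → SQAlgorithm M),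
          Distinguishes μ alg (uniformHypothesis M)
            (corruptedIsingHypothesis M m (δ / (m : ℝ)) ε) →
          ∃ P ∈ uniformHypothesis M ∪ corruptedIsingHypothesis M m (δ / (m : ℝ)) ε,
            ∃ O : QueryOracle M, O.IsSTAT P ∧
              0 < μ {ω | (∃ q ∈ (alg ω).queries O, q.tol < Real.sqrt (2 * τ)) ∨
                (2 : ℝ) ^ (a * (M : ℝ) ^ ((2 : ℝ) / 5)) * (M : ℝ) ^ (-((k : ℝ) + 1) / 5)
                  ≤ (((alg ω).queries O).length : ℝ)} := by
  -- `n₀` makes `(3/4)^(k+1)·720 ≤ A`; `n₁` gives `40000/A ≤ k ≤ z³` for `query_budget_lt`.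
  obtain ⟨n₀, hn₀⟩ := exists_pow_lt_of_lt_one (div_pos hA (by norm_num : (0 : ℝ) < 720))
    (by norm_num : (3 / 4 : ℝ) < 1)
  obtain ⟨n₁, hn₁⟩ := exists_nat_ge (40000 / A)
  refine ⟨max 1 (max n₀ n₁), 1 / 60000, 5000, 1 / 100, by norm_num, by norm_num, by norm_num, ?_⟩
  intro k hk m M ε δ τ hm hM hε hε2 hδ0 hδ hτ hmax Ω _ μ _ alg hd
  have hk1 : 1 ≤ k := (le_max_left _ _).trans hk
  have hkn0 : n₀ ≤ k := ((le_max_left _ _).trans (le_max_right _ _)).trans hk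
  have hkn1 : n₁ ≤ k := ((le_max_right _ _).trans (le_max_right _ _)).trans hk
  have hkR : (1 : ℝ) ≤ k := by exact_mod_cast hk1
  have hmR : (1 : ℝ) ≤ m := by exact_mod_cast hm
  have hk3 : (1 : ℝ) ≤ (k : ℝ) ^ 3 := one_le_pow₀ hkR
  have hmL : 5000 * Real.log (1 / ε) ^ 3 < m := (le_max_left _ _).trans_lt hmax
  have hδ' : 60000 * δ * (k : ℝ) ^ 3 ≤ ε * Real.log (1 / ε) := by
    have h := hδ
    rw [one_div_mul_eq_div, div_div, le_div_iff₀ (by positivity)] at h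
    linarith
  have hεL := IsingSQ.mul_log_one_div_le_one hε
  have hmM : m ≤ M := by
    have h1 : (m : ℝ) ≤ (m : ℝ) ^ ((5 : ℝ) / 4) := Real.self_le_rpow_of_one_le hmR (by norm_num)
    have : (m : ℝ) ≤ M := by rw [hM]; linarith
    exact_mod_cast this
  -- Otherwise the uniform distribution lies in both hypotheses, contradicting `hd`.
  have hεδ : ε < 60 * δ := by
    by_contra hcon
    obtain ⟨S, hS⟩ : ∃ S : Finset (Fin M), S.card = m := by
      obtain ⟨S, _, hS⟩ := Finset.exists_subset_card_eq
        (s := (Finset.univ : Finset (Fin M))) (n := m) (by simpa using hmM)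
      exact ⟨S, hS⟩
    refine IsingSQ.not_distinguishes_of_mem_inter μ alg (H₀ := uniformHypothesis M)
      (H₁ := corruptedIsingHypothesis M m (δ / (m : ℝ)) ε) (P := PMF.uniformOfFintype (Hypercube M))
      (Set.mem_singleton _) ⟨S, hS, ?_⟩ hd
    refine (IsingSQ.tvDistance_uniform_cliqueIsing_le hm hS hδ0.le ?_).trans (not_lt.1 hcon)
    nlinarith
  have hLk : 1000 * (k : ℝ) ^ 3 ≤ Real.log (1 / ε) := by
    by_contra hcon
    have h1 : ε * Real.log (1 / ε) ≤ ε * (1000 * (k : ℝ) ^ 3) := by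
      gcongr
      exact (not_le.1 hcon).le
    have h2 : ε * (1000 * (k : ℝ) ^ 3) < 60 * δ * (1000 * (k : ℝ) ^ 3) := by gcongr
    linarith
  have hmk : (k : ℝ) ^ 4 ≤ m := by
    have h1 : (k : ℝ) ^ 3 ≤ Real.log (1 / ε) := by linarith
    have h2 : ((k : ℝ) ^ 3) ^ 3 ≤ Real.log (1 / ε) ^ 3 := by gcongr
    have h3 : (k : ℝ) ^ 4 ≤ ((k : ℝ) ^ 3) ^ 3 := by
      rw [← pow_mul]
      exact pow_le_pow_right₀ hkR (by norm_num)
    nlinarith [(by positivity : (0 : ℝ) ≤ (k : ℝ) ^ 4)]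
  have hkA' : (3 / 4 : ℝ) ^ (k + 1) * 720 ≤ A := by
    have h1 : (3 / 4 : ℝ) ^ (k + 1) ≤ (3 / 4 : ℝ) ^ n₀ :=
      pow_le_pow_of_le_one (by norm_num) (by norm_num) (by omega)
    rw [lt_div_iff₀ (by norm_num)] at hn₀
    linarith
  exact ⟨PMF.uniformOfFintype (Hypercube M), Or.inl (Set.mem_singleton _),
    fun q => cubeExpectation (PMF.uniformOfFintype (Hypercube M)) q.f,
    fun q => by simp [q.tol_pos.le],
    IsingSQ.measure_pos_of_params hA hk1 (hn₁.trans (by exact_mod_cast hkn1)) hkA' hm hM hε hδ0 hεδ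
      hδ hτ hmL hmk μ alg hd⟩
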